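/- Let $M\subset\mathbb R^p\times\mathbb R^q$ be open, with coordinates $x=(x^1,\dots,x^p)$ and $u=(u^1,\dots,u^q)$, and let $r>0$, $N\in\mathbb N$. Let $\mathscr A$ be the algebra of differential functions $P[u,\varepsilon]=P(x,u^{(n)},\varepsilon)$ over $M$: smooth functions of $x$, $u$, finitely many derivatives $u^\alpha_J$, and the parameter $\varepsilon\in(-r,r)$. Let $D_i$ be the total derivatives and $\delta$ the variational derivative (Euler operator). Functionals $\int L\,dx$, $L\in\mathscr A$, are taken modulo total divergences of elements of $\mathscr A$. A function in $\mathscr A$ is $o(\varepsilon^N)$ if it is so as $\varepsilon\to0$ at every point, and a functional $\int L\,dx$ is $o(\varepsilon^N)$ if $L$ is the sum of a total divergence and an $o(\varepsilon^N)$ function. The same conventions are used for functional multi-vectors, i.e. alternating expressions in symbols $\theta^\alpha_J$ with coefficients in $\mathscr A$, on which $D_i$ acts as the derivation with $D_i\theta^\alpha_J=\theta^\alpha_{J,i}$, taken modulo total divergences; such an expression is $o(\varepsilon^N)$ if all its coefficients are. A $q\times q$ matrix $\mathscr D$ of differential operators $\sum_J P_JD_J$ (finite sums, $P_J\in\mathscr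 A$) is *skew-adjoint* if $\int (P\cdot\mathscr DQ+Q\cdot\mathscr DP)\,dx=0$ for all $P,Q\in\mathscr A^q$. It is *Hamiltonian* if the bracket $\{\mathscr P,\mathscr L\}=\int\delta\mathscr P\cdot\mathscr D\,\delta\mathscr L\,dx$ is skew-symmetric and satisfies the Jacobi identity, and *approximate Hamiltonian* if these two conditions hold up to $o(\varepsilon^N)$. Operators $\mathscr D,\mathscr E$ form an *approximately Hamiltonian pair* if both are skew-adjoint and $a\mathscr D+b\mathscr E$ is approximate Hamiltonian for all $a,b\in\mathbb R$. **Corollary.** Let $\mathscr D$ and $\mathscr E$ be Hamiltonian operators. Then $\mathscr D,\mathscr E$ form an approximately Hamiltonian pair if and only if $$\mathbf{pr\,v}_{\mathscr D\theta}(\Theta_{\mathscr E})+\mathbf{pr\,v}_{\mathscr E\theta}(\Theta_{\mathscr D})=o(\varepsilon^N),$$ where $\Theta_{\mathscr D}=\frac12\int\{\theta\wedge\mathscr D\theta\}\,dx$ and $\Theta_{\mathscr E}=\frac12\int\{\theta\wedge\mathscr E\theta\}\,dx$ are the functional bi-vectors of the two Poisson brackets, and $\mathbf{pr\,v}_{\mathscr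 D\theta}=\sum_{\alpha,J}D_J\big((\mathscr D\theta)_\alpha\big)\,\partial/\partial u^\alpha_J$ acts on the coefficients of multi-vectors, the uni-vectors $D_J((\mathscr D\theta)_\alpha)$ being wedged in from the left. The same equivalence holds if $\mathscr D$ and $\mathscr E$ are only assumed to be skew-adjoint and approximate Hamiltonian. -/

import Mathlib

open scoped ContDiff Topology

noncomputable section

namespace ApproxHam

/-- Symmetric multi-indices: `J i` counts the differentiations with respect to `x i`. -/
abbrev MultiIndex (p : ℕ) : Type := Fin p →₀ ℕ

/-- Coordinates on the infinite jet space of `p` independent and `q` dependent variables,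
together with the small parameter: `x i`, `u α J` (the jet variable `u^α_J`) and `eps`. -/
inductive Coord (p q : ℕ) : Type where
  | x (i : Fin p) : Coord p q
  | u (α : Fin q) (J : MultiIndex p) : Coord p q
  | eps : Coord p q

instance (p q : ℕ) : DecidableEq (Coord p q) := Classical.decEq _

/-- Points of the infinite jet space, together with a value of the parameter. -/
abbrev Jet (p q : ℕ) : Type := Coord p q → ℝ

/-- An open set `M` in the space of the variables `(x, u)`. -/
abbrev BaseDomain (p q : ℕ) : Type := TopologicalSpace.Opens ((Fin p → ℝ) × (Fin q → ℝ))

/-- The jets over `M`, with parameter values in the interval `(-r, r)`. Only `x` and `u` (not the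
derivatives of `u`) are restricted by `M`. -/
def jetDomain {p q : ℕ} (M : BaseDomain p q) (r : ℝ) : Set (Jet p q) :=
  {z | ((fun i => z (.x i)), (fun α => z (.u α 0))) ∈ M ∧ z .eps ∈ Set.Ioo (-r) r}

variable {p q : ℕ} {M : BaseDomain p q} {r : ℝ}

theorem isOpen_jetDomain : IsOpen (jetDomain M r) := by
  have h1 : Continuous (fun z : Jet p q =>
      ((fun i : Fin p => z (.x i)), (fun α : Fin q => z (.u α 0)))) := by fun_prop
  have h2 : Continuous (fun z : Jet p q => z .eps) := by fun_prop
  exact (M.isOpen.preimage h1).inter (isOpen_Ioo.preimage h2)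

/-- `f` is a smooth function of finitely many of the coordinates: `f = P(x, u⁽ⁿ⁾, ε)`.
(The points at which `g` has to be smooth form an open set.) -/
def IsDifferentialFunction (f : jetDomain M r → ℝ) : Prop :=
  ∃ (S : Finset (Coord p q)) (g : (S → ℝ) → ℝ), ∀ z : jetDomain M r,
    ContDiffAt ℝ ∞ g (fun c => z.1 c.1) ∧ f z = g (fun c => z.1 c.1)

theorem IsDifferentialFunction.comp₂ {f₁ f₂ : jetDomain M r → ℝ}
    (h₁ : IsDifferentialFunction f₁) (h₂ : IsDifferentialFunction f₂)
    {φ : ℝ × ℝ → ℝ} (hφ : ContDiff ℝ ∞ φ) :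
    IsDifferentialFunction (fun z => φ (f₁ z, f₂ z)) := by
  obtain ⟨S₁, g₁, h₁⟩ := h₁
  obtain ⟨S₂, g₂, h₂⟩ := h₂
  let i₁ : S₁ → ↥(S₁ ∪ S₂) := fun c => ⟨c.1, Finset.mem_union_left _ c.2⟩
  let i₂ : S₂ → ↥(S₁ ∪ S₂) := fun c => ⟨c.1, Finset.mem_union_right _ c.2⟩
  refine ⟨S₁ ∪ S₂, fun w => φ (g₁ (fun c => w (i₁ c)), g₂ (fun c => w (i₂ c))), fun z => ⟨?_, ?_⟩⟩
  · have e₁ : ContDiff ℝ ∞ (fun w : ↥(S₁ ∪ S₂) → ℝ => fun c => w (i₁ c)) := by fun_prop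
    have e₂ : ContDiff ℝ ∞ (fun w : ↥(S₁ ∪ S₂) → ℝ => fun c => w (i₂ c)) := by fun_prop
    have k₁ := ContDiffAt.comp (fun c : ↥(S₁ ∪ S₂) => z.1 c.1) (h₁ z).1 e₁.contDiffAt
    have k₂ := ContDiffAt.comp (fun c : ↥(S₁ ∪ S₂) => z.1 c.1) (h₂ z).1 e₂.contDiffAt
    exact hφ.contDiffAt.comp (fun c : ↥(S₁ ∪ S₂) => z.1 c.1) (k₁.prodMk k₂)
  · simp only [(h₁ z).2, (h₂ z).2, i₁, i₂]

variable (M r) in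
/-- The algebra `𝒜` of differential functions `P[u, ε] = P(x, u⁽ⁿ⁾, ε)` over `M`. -/
def 𝒜 : Subalgebra ℝ (jetDomain M r → ℝ) where
  carrier := {f | IsDifferentialFunction f}
  add_mem' h₁ h₂ := h₁.comp₂ h₂ (φ := fun y => y.1 + y.2) (by fun_prop)
  mul_mem' h₁ h₂ := h₁.comp₂ h₂ (φ := fun y => y.1 * y.2) (by fun_prop)
  algebraMap_mem' a := ⟨∅, fun _ => a, fun _ => ⟨contDiffAt_const, rfl⟩⟩

/-- A coordinate, as a differential function. -/
def coordFun (c : Coord p q) : 𝒜 M r :=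
  ⟨fun z => z.1 c, {c}, fun w => w ⟨c, Finset.mem_singleton_self c⟩, fun z =>
    ⟨(by fun_prop : ContDiff ℝ ∞ fun w : ({c} : Finset (Coord p q)) → ℝ =>
      w ⟨c, Finset.mem_singleton_self c⟩).contDiffAt, rfl⟩⟩

/-- Restriction of `f` to the line through `z` in the direction of the coordinate `c` (with value
`0` where this line has left the domain). -/
def slice (f : jetDomain M r → ℝ) (c : Coord p q) (z : jetDomain M r) (s : ℝ) : ℝ :=
  Function.extend Subtype.val f 0 (Function.update z.1 c s)

/-- The partial derivative of a function on the jet domain with respect to the coordinate `c`. -/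
def rawPartial (c : Coord p q) (f : jetDomain M r → ℝ) (z : jetDomain M r) : ℝ :=
  deriv (slice f c z) (z.1 c)

theorem slice_eventuallyEq {f : jetDomain M r → ℝ} {S : Finset (Coord p q)} {g : (S → ℝ) → ℝ}
    (h : ∀ z : jetDomain M r, f z = g (fun c => z.1 c.1)) (c : Coord p q) (z : jetDomain M r) :
    slice f c z =ᶠ[𝓝 (z.1 c)] fun s => g (fun d => Function.update z.1 c s d.1) := by
  have hc : Continuous (fun s : ℝ => Function.update z.1 c s) :=
    continuous_const.update c continuous_id
  have hz : (fun s : ℝ => Function.update z.1 c s) ⁻¹' jetDomain M r ∈ 𝓝 (z.1 c) := by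
    refine (isOpen_jetDomain.preimage hc).mem_nhds ?_
    simp [z.2]
  filter_upwards [hz] with s hs
  have := Subtype.val_injective.extend_apply f 0 (⟨_, hs⟩ : jetDomain M r)
  simp only [slice]
  rw [this, h]

theorem rawPartial_eq {f : jetDomain M r → ℝ} {S : Finset (Coord p q)} {g : (S → ℝ) → ℝ}
    (h : ∀ z : jetDomain M r, ContDiffAt ℝ ∞ g (fun c => z.1 c.1) ∧ f z = g (fun c => z.1 c.1))
    (c : Coord p q) (z : jetDomain M r) :
    rawPartial c f z = fderiv ℝ g (fun c => z.1 c.1) (fun d => if d.1 = c then 1 else 0) := by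
  unfold rawPartial
  rw [(slice_eventuallyEq (fun z => (h z).2) c z).deriv_eq]
  have h1 : HasDerivAt (fun s : ℝ => fun d : S => Function.update z.1 c s d.1)
      (fun d => if d.1 = c then 1 else 0) (z.1 c) := by
    rw [hasDerivAt_pi]
    intro d
    by_cases hd : d.1 = c
    · simpa [hd] using hasDerivAt_id' (z.1 c)
    · simpa [hd] using hasDerivAt_const (z.1 c) (z.1 d.1)
  have h2 : DifferentiableAt ℝ g (fun d : S => Function.update z.1 c (z.1 c) d.1) := by
    simpa using (h z).1.differentiableAt (by simp)
  simpa [Function.comp_def] using (h2.hasFDerivAt.comp_hasDerivAt (z.1 c) h1).deriv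

theorem IsDifferentialFunction.rawPartial {f : jetDomain M r → ℝ}
    (h : IsDifferentialFunction f) (c : Coord p q) :
    IsDifferentialFunction (rawPartial c f) := by
  obtain ⟨S, g, h⟩ := h
  refine ⟨S, fun w => fderiv ℝ g w (fun d => if d.1 = c then 1 else 0), fun z => ⟨?_, ?_⟩⟩
  · exact ((h z).1.fderiv_right (m := ∞) (by simp)).clm_apply contDiffAt_const
  · exact rawPartial_eq h c z

/-- The partial derivative `∂/∂c` on differential functions. -/
def pderiv (c : Coord p q) (f : 𝒜 M r) : 𝒜 M r := ⟨rawPartial c f.1, f.2.rawPartial c⟩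

/-- A differential function depends on finitely many coordinates only; so all the sums over
multi-indices below have finitely many nonzero terms. -/
theorem finite_pderiv_ne_zero (f : 𝒜 M r) : {c | pderiv c f ≠ 0}.Finite := by
  obtain ⟨f, S, g, h⟩ := f
  refine S.finite_toSet.subset fun c hc => ?_
  by_contra hcS
  refine hc (Subtype.ext (funext fun z => ?_))
  change rawPartial c f z = 0
  rw [rawPartial_eq h]
  have : (fun d : S => if d.1 = c then (1 : ℝ) else 0) = 0 := by
    funext d
    have : d.1 ≠ c := fun e => hcS (by simp [← e])
    simp [this]
  rw [this, map_zero]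

/-- Labels `(α, J)` of the jet variables `u^α_J` and of the basic uni-vectors `θ^α_J`. -/
abbrev Lab (p q : ℕ) : Type := Fin q × MultiIndex p

/-- `(α, J) ↦ (α, (J, i))`. -/
def Lab.incr (i : Fin p) (c : Lab p q) : Lab p q := (c.1, c.2 + Finsupp.single i 1)

/-- The jet variable `u^α_J`, where `c = (α, J)`. -/
def Lab.u (c : Lab p q) : Coord p q := .u c.1 c.2

/-- The total derivative `D_i = ∂/∂x^i + ∑ u^α_{J,i} ∂/∂u^α_J`. -/
def totalDeriv (i : Fin p) (f : 𝒜 M r) : 𝒜 M r :=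
  pderiv (.x i) f + ∑ᶠ c : Lab p q, coordFun (c.incr i).u * pderiv c.u f

/-- Iterated operators `T_J = ∏_i T_i ^ (J i)` (used for commuting operators only). -/
def iterOp {V : Type*} (T : Fin p → V → V) (J : MultiIndex p) (v : V) : V :=
  (List.finRange p).foldr (fun i w => (T i)^[J i] w) v

/-- The total divergence. -/
def divergence (X : Fin p → 𝒜 M r) : 𝒜 M r := ∑ i, totalDeriv i (X i)

/-- The Euler operator (variational derivative): the density of a functional is sent to
`E_α(L) = ∑_J (-D)_J ∂L/∂u^α_J`. -/
def euler (L : 𝒜 M r) (α : Fin q) : 𝒜 M r :=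
  ∑ᶠ J : MultiIndex p, (-1 : 𝒜 M r) ^ J.degree * iterOp totalDeriv J (pderiv (.u α J) L)

/-- `f = o(ε^N)`. As `f` is jointly smooth, it makes no difference whether this is
required at each point or locally uniformly. -/
def IsSmall (N : ℕ) (f : 𝒜 M r) : Prop :=
  ∀ z : jetDomain M r, slice f.1 .eps z =o[𝓝 0] fun e : ℝ => e ^ N

/-- The functional `∫ L dx` vanishes: functionals are densities modulo total divergences. -/
def IntegralZero (L : 𝒜 M r) : Prop := ∃ X : Fin p → 𝒜 M r, L = divergence X

/-- The functional `∫ L dx` is `o(ε^N)`. -/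
def IntegralSmall (N : ℕ) (L : 𝒜 M r) : Prop :=
  ∃ X : Fin p → 𝒜 M r, IsSmall N (L - divergence X)

variable (M r) in
/-- A `q × q` matrix of differential operators `𝒟_{αβ} = ∑_J P_J[u, ε] D_J`, given by its
coefficients: `P_J = 𝒟 α β J`. -/
abbrev MatDiffOp : Type := Matrix (Fin q) (Fin q) (MultiIndex p →₀ 𝒜 M r)

/-- The action of a matrix differential operator on `𝒜^q`. -/
def MatDiffOp.apply (D : MatDiffOp M r) (Q : Fin q → 𝒜 M r) (α : Fin q) : 𝒜 M r :=
  ∑ β, (D α β).sum fun J P => P * iterOp totalDeriv J (Q β)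

/-- `D'` is the formal adjoint of `D`: `∫ P · D Q dx = ∫ Q · D' P dx`. -/
def IsAdjoint (D D' : MatDiffOp M r) : Prop :=
  ∀ P Q : Fin q → 𝒜 M r,
    IntegralZero (∑ α, P α * MatDiffOp.apply D Q α - ∑ α, Q α * MatDiffOp.apply D' P α)

/-- `D* = -D`. -/
def IsSkewAdjoint (D : MatDiffOp M r) : Prop := IsAdjoint D (-D)

/-- A density of the bracket `{∫ P dx, ∫ L dx} = ∫ δP · D δL dx`. -/
def bracket (D : MatDiffOp M r) (P L : 𝒜 M r) : 𝒜 M r :=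
  ∑ α, euler P α * MatDiffOp.apply D (euler L) α

/-- `D` is Hamiltonian: its bracket is skew-symmetric and satisfies the Jacobi identity. -/
def IsHamiltonian (D : MatDiffOp M r) : Prop :=
  (∀ P L : 𝒜 M r, IntegralZero (bracket D P L + bracket D L P)) ∧
  ∀ P L R : 𝒜 M r, IntegralZero (bracket D (bracket D P L) R + bracket D (bracket D L R) P +
    bracket D (bracket D R P) L)

/-- `D` is approximate Hamiltonian: skew-symmetry and the Jacobi identity hold up to `o(ε^N)`. -/
def IsApproxHamiltonian (N : ℕ) (D : MatDiffOp M r) : Prop :=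
  (∀ P L : 𝒜 M r, IntegralSmall N (bracket D P L + bracket D L P)) ∧
  ∀ P L R : 𝒜 M r, IntegralSmall N (bracket D (bracket D P L) R + bracket D (bracket D L R) P +
    bracket D (bracket D R P) L)

/-- `D`, `E` are skew-adjoint and every real linear combination of them is approximate
Hamiltonian. -/
def IsApproxHamiltonianPair (N : ℕ) (D E : MatDiffOp M r) : Prop :=
  IsSkewAdjoint D ∧ IsSkewAdjoint E ∧ ∀ a b : ℝ, IsApproxHamiltonian N (a • D + b • E)

variable (M r) in
/-- Formal sums of monomials `P θ^{α₁}_{J₁} ∧ ⋯ ∧ θ^{α_k}_{J_k}` with `P` in `𝒜`: the monomial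
with labels `a` has coefficient `η a`. They represent vertical `k`-vectors; two of them represent
the same `k`-vector when their antisymmetrized coefficients (see `altCoeff`) agree. -/
abbrev MultiVec (k : ℕ) : Type := (Fin k → Lab p q) →₀ 𝒜 M r

/-- The coefficient of `θ_{a 0} ∧ ⋯ ∧ θ_{a (k-1)}` after collecting all monomials that differ by
a permutation of their factors; it is `0` if a label is repeated. -/
def altCoeff {k : ℕ} (η : MultiVec M r k) (a : Fin k → Lab p q) : 𝒜 M r :=
  ∑ σ : Equiv.Perm (Fin k), (Equiv.Perm.sign σ : ℤ) • η (a ∘ σ)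

/-- The total derivative of multi-vectors: the derivation with `D_i θ^α_J = θ^α_{J,i}` which
extends `D_i` on `𝒜`. -/
def MultiVec.totalDeriv {k : ℕ} (i : Fin p) (η : MultiVec M r k) : MultiVec M r k :=
  η.sum fun a P => Finsupp.single a (ApproxHam.totalDeriv i P) +
    ∑ s : Fin k, Finsupp.single (Function.update a s ((a s).incr i)) P

/-- The functional multi-vector `∫ η dx` is `o(ε^N)`: modulo total divergences of multi-vectors,
all its coefficients are. -/
def MultiVec.IntegralSmall {k : ℕ} (N : ℕ) (η : MultiVec M r k) : Prop :=
  ∃ X : Fin p → MultiVec M r k, ∀ a : Fin k → Lab p q,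
    IsSmall N (altCoeff (η - ∑ i, MultiVec.totalDeriv i (X i)) a)

/-- The uni-vector `(Dθ)_α = ∑_{β,J} D_{αβ}^J θ^β_J`. -/
def opTheta (D : MatDiffOp M r) (α : Fin q) : MultiVec M r 1 :=
  ∑ β, (D α β).sum fun J P => Finsupp.single (fun _ => (β, J)) P

/-- The wedge product of a uni-vector and a `k`-vector. -/
def MultiVec.wedge {k : ℕ} (v : MultiVec M r 1) (η : MultiVec M r k) : MultiVec M r (k + 1) :=
  v.sum fun b Q => η.sum fun a P => Finsupp.single (Fin.cons (b 0) a) (Q * P)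

/-- (The integrand of) the bi-vector `Θ_D = ½ ∫ {θ ∧ Dθ} dx`. -/
def bivector (D : MatDiffOp M r) : MultiVec M r 2 :=
  (1 / 2 : ℝ) • ∑ α, MultiVec.wedge (Finsupp.single (fun _ => (α, 0)) 1) (opTheta D α)

/-- `pr v_{Dθ} = ∑_{α,J} D_J((Dθ)_α) ∂/∂u^α_J`, where `∂/∂u^α_J` acts on the coefficients:
`P θ_{a₁} ∧ ⋯ ∧ θ_{a_k} ↦ ∑_{α,J} ∂P/∂u^α_J D_J((Dθ)_α) ∧ θ_{a₁} ∧ ⋯ ∧ θ_{a_k}`. -/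
def prolong {k : ℕ} (D : MatDiffOp M r) (η : MultiVec M r k) : MultiVec M r (k + 1) :=
  η.sum fun a P => ∑ᶠ c : Lab p q,
    MultiVec.wedge (iterOp MultiVec.totalDeriv c.2 (opTheta D c.1))
      (Finsupp.single a (pderiv c.u P))

end ApproxHam

end

/-!
All conditions are considered modulo an ideal `I` of differential functions which is stable under
partial derivatives (`0`, or the functions which are `o(ε^N)`), and total divergences.

For a skew-adjoint operator `D` the Jacobi identity says that the cyclic sum of
`∫ δQ · D'[D δP] δR dx` vanishes: the second derivatives of `P`, `Q`, `R` cancel, because the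
Fréchet derivative of a variational derivative is self-adjoint. This cyclic sum is quadratic in `D`,
so that, given the Jacobi identities for `D` and `E`, those for all `aD + bE` amount to the
vanishing of the mixed term. The mixed term is the value of `pr v_{Dθ}(Θ_E) + pr v_{Eθ}(Θ_D)` on
the variational derivatives of `P`, `Q`, `R`.

It remains to see that a functional multi-vector is zero once it vanishes on all variational
derivatives. Integrating by parts frees its first factor `θ^α` of derivatives; the coefficients of
this normal form are then detected by `φ(x) = δ(φ u^α)` and `φ(x) u^α = δ(½ φ (u^α)²)`.
-/

open scoped ContDiff Topology

noncomputable section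

namespace ApproxHam

variable {p q : ℕ} {M : BaseDomain p q} {r : ℝ}

-- Without this shortcut the instance is not found within the default synthesis limits.
local instance : AddCommGroup (𝒜 M r) := inferInstance

/-! ### Partial derivatives -/

theorem slice_apply (f : jetDomain M r → ℝ) (c : Coord p q) (z : jetDomain M r) {s : ℝ}
    (h : Function.update z.1 c s ∈ jetDomain M r) :
    slice f c z s = f ⟨Function.update z.1 c s, h⟩ :=
  Subtype.val_injective.extend_apply f 0 (⟨_, h⟩ : jetDomain M r)

theorem slice_self (f : jetDomain M r → ℝ) (c : Coord p q) (z : jetDomain M r) :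
    slice f c z (z.1 c) = f z := by
  rw [slice_apply f c z (by simp [z.2])]
  congr 1
  exact Subtype.ext (Function.update_eq_self c z.1)

theorem eventually_update_mem (c : Coord p q) (z : jetDomain M r) :
    ∀ᶠ s in 𝓝 (z.1 c), Function.update z.1 c s ∈ jetDomain M r := by
  have hc : Continuous (fun s : ℝ => Function.update z.1 c s) :=
    continuous_const.update c continuous_id
  exact (isOpen_jetDomain.preimage hc).mem_nhds (by simp [z.2])

theorem contDiffAt_slice (f : 𝒜 M r) (c : Coord p q) (z : jetDomain M r) :
    ContDiffAt ℝ ∞ (slice f.1 c z) (z.1 c) := by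
  obtain ⟨f, S, g, h⟩ := f
  refine ContDiffAt.congr_of_eventuallyEq ?_ (slice_eventuallyEq (fun z => (h z).2) c z)
  have h1 : ContDiff ℝ ∞ (fun s : ℝ => fun d : S => Function.update z.1 c s d.1) := by
    rw [contDiff_pi]
    intro d
    by_cases hd : d.1 = c
    · simpa [hd] using contDiff_fun_id
    · simpa [hd] using contDiff_const
  refine ContDiffAt.comp (z.1 c) ?_ h1.contDiffAt
  simpa using (h z).1

theorem hasDerivAt_slice (f : 𝒜 M r) (c : Coord p q) (z : jetDomain M r) :
    HasDerivAt (slice f.1 c z) ((pderiv c f).1 z) (z.1 c) :=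
  ((contDiffAt_slice f c z).differentiableAt (by simp)).hasDerivAt

theorem pderiv_apply_eq {f : 𝒜 M r} {c : Coord p q} {z : jetDomain M r} {φ : ℝ → ℝ} {a : ℝ}
    (h : HasDerivAt φ a (z.1 c))
    (hφ : ∀ s, ∀ hs : Function.update z.1 c s ∈ jetDomain M r, f.1 ⟨_, hs⟩ = φ s) :
    (pderiv c f).1 z = a := by
  refine (hasDerivAt_slice f c z).unique (h.congr_of_eventuallyEq ?_)
  filter_upwards [eventually_update_mem c z] with s hs
  rw [slice_apply _ _ _ hs, hφ]

/-- `pderiv c`, bundled as a derivation. -/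
def partialD (c : Coord p q) : Derivation ℝ (𝒜 M r) (𝒜 M r) :=
  Derivation.mk'
    { toFun := pderiv c
      map_add' := fun f g => Subtype.ext <| funext fun z =>
        pderiv_apply_eq ((hasDerivAt_slice f c z).add (hasDerivAt_slice g c z)) fun s hs => by
          simp [slice_apply _ _ _ hs]
      map_smul' := fun a f => Subtype.ext <| funext fun z =>
        pderiv_apply_eq ((hasDerivAt_slice f c z).const_mul a) fun s hs => by
          simp [slice_apply _ _ _ hs] }
    fun f g => Subtype.ext <| funext fun z =>
      (pderiv_apply_eq ((hasDerivAt_slice f c z).mul (hasDerivAt_slice g c z)) fun s hs => by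
          simp [slice_apply _ _ _ hs]).trans <| by
        simp [slice_self, mul_comm, add_comm]

theorem pderiv_comm (c d : Coord p q) (f : 𝒜 M r) :
    pderiv c (pderiv d f) = pderiv d (pderiv c f) := by
  obtain ⟨f, S, g, h⟩ := f
  refine Subtype.ext (funext fun z => ?_)
  have key : ∀ c d : Coord p q, rawPartial c (rawPartial d f) z =
      fderiv ℝ (fderiv ℝ g) (fun c => z.1 c.1) (fun e => if e.1 = c then 1 else 0)
        (fun e => if e.1 = d then 1 else 0) := by
    intro c d
    have hs : ∀ z : jetDomain M r, ContDiffAt ℝ ∞ (fderiv ℝ g) (fun c => z.1 c.1) := fun z =>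
      (h z).1.fderiv_right (m := ∞) (by simp)
    rw [rawPartial_eq (S := S) (g := fun w => fderiv ℝ g w (fun e => if e.1 = d then 1 else 0))
      (fun z => ⟨(hs z).clm_apply contDiffAt_const, rawPartial_eq h d z⟩)]
    rw [fderiv_clm_apply ((hs z).differentiableAt (by simp)) (differentiableAt_const _)]
    simp
  change rawPartial c (rawPartial d f) z = rawPartial d (rawPartial c f) z
  rw [key, key]
  exact (h z).1.isSymmSndFDerivAt (by simpa using WithTop.coe_le_coe.2 (le_top : (2 : ℕ∞) ≤ ⊤)) _ _

theorem pderiv_coordFun (c d : Coord p q) :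
    pderiv c (coordFun d : 𝒜 M r) = if d = c then 1 else 0 := by
  refine Subtype.ext (funext fun z => ?_)
  by_cases h : d = c
  · subst h
    rw [if_pos rfl]
    exact pderiv_apply_eq (hasDerivAt_id' _) fun s hs => by simp [coordFun]
  · rw [if_neg h]
    exact pderiv_apply_eq (hasDerivAt_const _ (z.1 d)) fun s hs => by simp [coordFun, h]

/-! ### Vector fields on the jet space -/

/-- The differential `f ↦ (∂f/∂c)_c`; only finitely many components are nonzero. -/
def gradient : Derivation ℝ (𝒜 M r) (Coord p q →₀ 𝒜 M r) :=
  Derivation.mk'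
    { toFun := fun f => Finsupp.ofSupportFinite (fun c => partialD c f) (finite_pderiv_ne_zero f)
      map_add' := fun f g => Finsupp.ext fun c => by
        rw [Finsupp.add_apply]; exact (partialD c).map_add f g
      map_smul' := fun a f => Finsupp.ext fun c => by
        rw [Finsupp.smul_apply]; exact (partialD c).map_smul a f }
    fun f g => Finsupp.ext fun c => (partialD c).leibniz f g

theorem gradient_apply (f : 𝒜 M r) (c : Coord p q) : gradient f c = pderiv c f := rfl

theorem gradient_coordFun (c : Coord p q) :
    gradient (coordFun c : 𝒜 M r) = Finsupp.single c 1 := by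
  ext d : 1
  rw [gradient_apply, pderiv_coordFun, Finsupp.single_apply]

/-- The vector field `∑_c v_c ∂/∂c` on the jet space. -/
def vectorField (v : Coord p q → 𝒜 M r) : Derivation ℝ (𝒜 M r) (𝒜 M r) :=
  (Finsupp.linearCombination (𝒜 M r) v).compDer gradient

theorem vectorField_apply (v : Coord p q → 𝒜 M r) (f : 𝒜 M r) :
    vectorField v f = Finsupp.linearCombination (𝒜 M r) v (gradient f) := rfl

theorem vectorField_eq_sum {f : 𝒜 M r} {s : Finset (Coord p q)} (hs : (gradient f).support ⊆ s)
    (v : Coord p q → 𝒜 M r) : vectorField v f = ∑ c ∈ s, pderiv c f * v c := by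
  rw [vectorField_apply, Finsupp.linearCombination_apply,
    Finsupp.sum_of_support_subset (gradient f) hs (fun c a => a • v c) fun _ _ => zero_smul _ _]
  rfl

theorem vectorField_coordFun (v : Coord p q → 𝒜 M r) (c : Coord p q) :
    vectorField v (coordFun c) = v c := by
  rw [vectorField_apply, gradient_coordFun, Finsupp.linearCombination_single, one_smul]

theorem vectorField_add (v w : Coord p q → 𝒜 M r) :
    vectorField (v + w) = vectorField v + vectorField w := by
  ext f : 1
  simp only [Derivation.add_apply, vectorField_eq_sum subset_rfl, Pi.add_apply, mul_add,
    Finset.sum_add_distrib]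

theorem support_gradient_pderiv_subset (c : Coord p q) (f : 𝒜 M r) :
    (gradient (pderiv c f)).support ⊆ (gradient f).support := fun d => by
  simp only [Finsupp.mem_support_iff, gradient_apply, pderiv_comm d c]
  exact mt fun h => (congrArg _ h).trans (partialD c).map_zero

theorem vectorField_vectorField (v w : Coord p q → 𝒜 M r) (f : 𝒜 M r) :
    vectorField v (vectorField w f) = vectorField (fun c => vectorField v (w c)) f +
      ∑ c ∈ (gradient f).support, ∑ d ∈ (gradient f).support,
        w c * v d * pderiv d (pderiv c f) := by
  rw [vectorField_eq_sum subset_rfl w, map_sum, vectorField_eq_sum subset_rfl fun c =>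
    vectorField v (w c), ← Finset.sum_add_distrib]
  refine Finset.sum_congr rfl fun c _ => ?_
  rw [Derivation.leibniz, vectorField_eq_sum (support_gradient_pderiv_subset c f), smul_eq_mul,
    smul_eq_mul, Finset.mul_sum]
  congr 1
  exact Finset.sum_congr rfl fun d _ => by ring

theorem vectorField_commutator (v w : Coord p q → 𝒜 M r) :
    ⁅vectorField v, vectorField w⁆ =
      vectorField fun c => vectorField v (w c) - vectorField w (v c) := by
  ext f : 1
  have symm : ∑ c ∈ (gradient f).support, ∑ d ∈ (gradient f).support,
      w c * v d * pderiv d (pderiv c f) = ∑ c ∈ (gradient f).support,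
        ∑ d ∈ (gradient f).support, v c * w d * pderiv d (pderiv c f) := by
    rw [Finset.sum_comm]
    refine Finset.sum_congr rfl fun c _ => Finset.sum_congr rfl fun d _ => ?_
    rw [pderiv_comm, mul_comm (w d)]
  rw [Derivation.commutator_apply, vectorField_vectorField v w, vectorField_vectorField w v, symm]
  simp only [add_sub_add_right_eq_sub, vectorField_eq_sum subset_rfl, mul_sub,
    Finset.sum_sub_distrib]

theorem vectorField_comm {v w : Coord p q → 𝒜 M r}
    (h : ∀ c, vectorField v (w c) = vectorField w (v c)) (f : 𝒜 M r) :
    vectorField v (vectorField w f) = vectorField w (vectorField v f) := by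
  rw [← sub_eq_zero, ← Derivation.commutator_apply, vectorField_commutator,
    vectorField_eq_sum subset_rfl]
  simp only [h, sub_self, mul_zero, Finset.sum_const_zero]

theorem Lab.u_injective : Function.Injective (Lab.u : Lab p q → Coord p q) := by
  rintro ⟨α, J⟩ ⟨β, K⟩ h
  simpa [Lab.u] using h

/-- The part of the differential which involves the jet variables only: `f ↦ (∂f/∂u^α_J)_{α,J}`. -/
def jetGradient : Derivation ℝ (𝒜 M r) (Lab p q →₀ 𝒜 M r) :=
  (Finsupp.lcomapDomain Lab.u Lab.u_injective : _ →ₗ[𝒜 M r] _).compDer gradient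

theorem jetGradient_apply (f : 𝒜 M r) (c : Lab p q) : jetGradient f c = pderiv c.u f := rfl

theorem jetGradient_coordFun_u (c : Lab p q) :
    jetGradient (coordFun c.u : 𝒜 M r) = Finsupp.single c 1 := by
  ext d : 1
  rw [jetGradient_apply, pderiv_coordFun, Finsupp.single_apply]
  simp only [Lab.u_injective.eq_iff]

theorem jetGradient_coordFun_x (i : Fin p) : jetGradient (coordFun (.x i) : 𝒜 M r) = 0 := by
  ext d : 1
  rw [jetGradient_apply, pderiv_coordFun, if_neg nofun, Finsupp.coe_zero, Pi.zero_apply]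

/-- The coefficients of the vector field `∑_{α,J} v^α_J ∂/∂u^α_J`. -/
def verticalCoeff (v : Lab p q → 𝒜 M r) : Coord p q → 𝒜 M r
  | .u α J => v (α, J)
  | _ => 0

theorem verticalCoeff_u (v : Lab p q → 𝒜 M r) (c : Lab p q) : verticalCoeff v c.u = v c := rfl

theorem vectorField_verticalCoeff (v : Lab p q → 𝒜 M r) (f : 𝒜 M r) :
    vectorField (verticalCoeff v) f = Finsupp.linearCombination (𝒜 M r) v (jetGradient f) := by
  suffices Finsupp.linearCombination (𝒜 M r) (verticalCoeff v) =
      Finsupp.linearCombination (𝒜 M r) v ∘ₗ Finsupp.lcomapDomain Lab.u Lab.u_injective from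
    LinearMap.congr_fun this (gradient f)
  refine Finsupp.lhom_ext' fun c => LinearMap.ext_ring ?_
  have hother (hc : c ∉ Set.range Lab.u) :
      Finsupp.comapDomain Lab.u (Finsupp.single c (1 : 𝒜 M r)) Lab.u_injective.injOn = 0 := by
    ext d : 1
    exact Finsupp.single_eq_of_ne fun h => hc ⟨d, h⟩
  cases c with
  | u α J =>
    rw [show Coord.u α J = Lab.u (α, J) from rfl]
    simp [verticalCoeff_u]
  | x j => simp [verticalCoeff, hother (by rintro ⟨d, hd⟩; cases hd)]
  | eps => simp [verticalCoeff, hother (by rintro ⟨d, hd⟩; cases hd)]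

theorem finsum_mul_pderiv (v : Lab p q → 𝒜 M r) (f : 𝒜 M r) :
    ∑ᶠ c, v c * pderiv c.u f = Finsupp.linearCombination (𝒜 M r) v (jetGradient f) := by
  rw [Finsupp.linearCombination_apply, finsum_eq_finsetSum_of_support_subset]
  · exact Finset.sum_congr rfl fun c _ => mul_comm _ _
  · intro c hc
    exact Finsupp.mem_support_iff.2 fun h => hc (mul_eq_zero_of_right _ h)

/-- The coefficients of the vector field `D_i`. -/
def totalCoeff (i : Fin p) : Coord p q → 𝒜 M r
  | .x j => if j = i then 1 else 0
  | .u α J => coordFun (Lab.incr i (α, J)).u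
  | .eps => 0

/-- The total derivative `totalDeriv i`, bundled as a derivation. -/
def totalD (i : Fin p) : Derivation ℝ (𝒜 M r) (𝒜 M r) := vectorField (totalCoeff i)

theorem totalDeriv_eq_totalD : (totalDeriv : Fin p → 𝒜 M r → 𝒜 M r) = fun i f => totalD i f := by
  ext1 i
  ext1 f
  have hv : totalCoeff i = Pi.single (.x i) 1 +
      verticalCoeff fun c => (coordFun (c.incr i).u : 𝒜 M r) := by
    ext1 c
    cases c <;> simp [totalCoeff, verticalCoeff, Pi.single_apply]
  have hx : vectorField (Pi.single (.x i) 1) f = pderiv (.x i) f := by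
    rw [vectorField_eq_sum (Finset.subset_insert (.x i) _),
      Finset.sum_eq_single_of_mem _ (Finset.mem_insert_self _ _) fun c _ hc => by simp [hc]]
    simp
  rw [totalDeriv, finsum_mul_pderiv, ← vectorField_verticalCoeff, totalD, hv, vectorField_add,
    Derivation.add_apply, hx]

theorem totalD_x (i j : Fin p) :
    totalD i (coordFun (.x j) : 𝒜 M r) = if j = i then 1 else 0 := vectorField_coordFun _ _

theorem totalD_u (i : Fin p) (c : Lab p q) :
    totalD i (coordFun c.u : 𝒜 M r) = coordFun (c.incr i).u := vectorField_coordFun _ _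

theorem Lab.incr_comm (i j : Fin p) (c : Lab p q) : (c.incr i).incr j = (c.incr j).incr i := by
  simp [Lab.incr, add_right_comm]

theorem totalD_comm (i j : Fin p) (f : 𝒜 M r) : totalD i (totalD j f) = totalD j (totalD i f) := by
  refine vectorField_comm (fun c => ?_) f
  cases c with
  | x k => simp only [totalCoeff]; split_ifs <;> simp
  | u α J =>
    exact (totalD_u i _).trans <|
      (congrArg (coordFun ∘ Lab.u) (Lab.incr_comm j i (α, J))).trans (totalD_u j _).symm
  | eps => simp [totalCoeff]

/-! ### Iterated operators -/

@[elab_as_elim]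
theorem MultiIndex.induction {P : MultiIndex p → Prop} (zero : P 0)
    (add_single : ∀ i J, P J → P (J + Finsupp.single i 1)) (J : MultiIndex p) : P J := by
  rw [← Finsupp.toMultiset_toFinsupp J]
  induction Finsupp.toMultiset J using Multiset.induction with
  | empty => simpa using zero
  | cons i s ih =>
    rw [← Multiset.singleton_add, Multiset.toFinsupp_add, Multiset.toFinsupp_singleton, add_comm]
    exact add_single i _ ih

theorem iterOp_zero {V : Type*} (T : Fin p → V → V) (v : V) : iterOp T 0 v = v := by
  unfold iterOp
  induction List.finRange p with
  | nil => rfl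
  | cons i l ih =>
    rw [List.foldr_cons, ih, Finsupp.coe_zero, Pi.zero_apply, Function.iterate_zero_apply]

theorem iterOp_add_single {V : Type*} {T : Fin p → V → V}
    (hT : ∀ i j v, T i (T j v) = T j (T i v)) (J : MultiIndex p) (i : Fin p) (v : V) :
    iterOp T (J + Finsupp.single i 1) v = T i (iterOp T J v) := by
  suffices ∀ l : List (Fin p), l.Nodup →
      l.foldr (fun k w => (T k)^[(J + Finsupp.single i 1 : MultiIndex p) k] w) v =
        if i ∈ l then T i (l.foldr (fun k w => (T k)^[J k] w) v)
          else l.foldr (fun k w => (T k)^[J k] w) v by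
    simpa [iterOp] using this (List.finRange p) (List.nodup_finRange p)
  intro l hl
  induction l with
  | nil => simp
  | cons a l ih =>
    have hal := (List.nodup_cons.1 hl).1
    rw [List.foldr_cons, List.foldr_cons, ih (List.nodup_cons.1 hl).2]
    by_cases h : a = i
    · subst h
      simp [hal, Function.iterate_succ_apply']
    · have hc (n w) : (T a)^[n] (T i w) = T i ((T a)^[n] w) :=
        (Function.Commute.iterate_left (fun w => hT a i w) n).eq w
      by_cases h' : i ∈ l
      · simp [h', hc, Ne.symm h]
      · simp [h', Ne.symm h]

theorem iterOp_semiconj {V W : Type*} {T : Fin p → V → V} {T' : Fin p → W → W}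
    {φ : V → W} (h : ∀ i v, φ (T i v) = T' i (φ v)) (J : MultiIndex p) (v : V) :
    φ (iterOp T J v) = iterOp T' J (φ v) := by
  unfold iterOp
  induction List.finRange p with
  | nil => rfl
  | cons i l ih =>
    rw [List.foldr_cons, List.foldr_cons, ← ih]
    exact (Function.Semiconj.iterate_right (f := φ) (h i) (J i)).eq _

theorem iterOp_linearMap {R V : Type*} [Semiring R] [AddCommMonoid V] [Module R V]
    (T : Fin p → Module.End R V) (J : MultiIndex p) (v : V) :
    iterOp (fun i => T i) J v = ((List.finRange p).map fun i => T i ^ J i).prod v := by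
  unfold iterOp
  induction List.finRange p with
  | nil => rfl
  | cons i l ih =>
    rw [List.foldr_cons, ih, List.map_cons, List.prod_cons, Module.End.mul_apply,
      Module.End.pow_apply]

/-- The iterated total derivative `D_J`, as a linear map. -/
def totalDJ (J : MultiIndex p) : Module.End ℝ (𝒜 M r) :=
  ((List.finRange p).map fun i => (totalD i).toLinearMap ^ J i).prod

theorem iterOp_totalDeriv (J : MultiIndex p) (f : 𝒜 M r) :
    iterOp totalDeriv J f = totalDJ J f := by
  rw [totalDeriv_eq_totalD]
  exact iterOp_linearMap (fun i => (totalD i).toLinearMap) J f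

theorem totalDJ_eq_iterOp (J : MultiIndex p) (f : 𝒜 M r) :
    totalDJ J f = iterOp (fun i f => totalD i f) J f := by
  rw [← iterOp_totalDeriv, totalDeriv_eq_totalD]

theorem totalDJ_zero (f : 𝒜 M r) : totalDJ 0 f = f := by
  rw [totalDJ_eq_iterOp, iterOp_zero]

theorem totalDJ_add_single (J : MultiIndex p) (i : Fin p) (f : 𝒜 M r) :
    totalDJ (J + Finsupp.single i 1) f = totalD i (totalDJ J f) := by
  rw [totalDJ_eq_iterOp, totalDJ_eq_iterOp, iterOp_add_single totalD_comm]

theorem map_totalDJ {φ : 𝒜 M r → 𝒜 M r} (h : ∀ i f, φ (totalD i f) = totalD i (φ f))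
    (J : MultiIndex p) (f : 𝒜 M r) : φ (totalDJ J f) = totalDJ J (φ f) := by
  rw [totalDJ_eq_iterOp, totalDJ_eq_iterOp, iterOp_semiconj h]

theorem totalDJ_totalD (J : MultiIndex p) (i : Fin p) (f : 𝒜 M r) :
    totalDJ J (totalD i f) = totalD i (totalDJ J f) :=
  (map_totalDJ (totalD_comm i) J f).symm

/-- `(-D)_J = (-1)^|J| D_J`. -/
def adjDJ (J : MultiIndex p) : Module.End ℝ (𝒜 M r) :=
  (-1 : ℝ) ^ J.degree • (totalDJ J : Module.End ℝ (𝒜 M r))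

theorem adjDJ_zero (f : 𝒜 M r) : adjDJ 0 f = f := by
  simp [adjDJ, totalDJ_zero]

theorem adjDJ_add_single (J : MultiIndex p) (i : Fin p) (f : 𝒜 M r) :
    adjDJ (J + Finsupp.single i 1) f = -totalD i (adjDJ J f) := by
  simp [adjDJ, totalDJ_add_single, pow_succ]

theorem adjDJ_totalD (J : MultiIndex p) (i : Fin p) (f : 𝒜 M r) :
    adjDJ J (totalD i f) = totalD i (adjDJ J f) := by
  simp [adjDJ, totalDJ_totalD]

/-! ### Functions which are `o(ε^N)` -/

section Taylor

variable {E : Type*} [NormedAddCommGroup E] [NormedSpace ℝ E] {φ : ℝ → E} {x₀ : ℝ}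

theorem isLittleO_sub_taylor {n : ℕ} (hφ : ContDiffAt ℝ n φ x₀) :
    (fun x => φ x - ∑ k ∈ Finset.range (n + 1),
      ((k.factorial : ℝ)⁻¹ * (x - x₀) ^ k) • iteratedDeriv k φ x₀) =o[𝓝 x₀]
        fun x => (x - x₀) ^ n := by
  obtain ⟨u, hu, -, hφu⟩ := hφ.contDiffWithinAt.contDiffOn le_rfl (by simp)
  rw [Set.insert_eq_of_mem (Set.mem_univ _), nhdsWithin_univ] at hu
  obtain ⟨ρ, hρ, hball⟩ := Metric.mem_nhds_iff.1 hu
  have hx₀ : x₀ ∈ Metric.ball x₀ ρ := Metric.mem_ball_self hρ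
  have taylor := taylor_isLittleO (convex_ball x₀ ρ) hx₀ (hφu.mono hball)
  simpa only [Metric.isOpen_ball.nhdsWithin_eq hx₀, taylor_within_apply,
    iteratedDerivWithin_of_isOpen Metric.isOpen_ball hx₀] using taylor

theorem eq_zero_of_pow_smul_isLittleO {n : ℕ} {a : E}
    (h : (fun x : ℝ => (x - x₀) ^ n • a) =o[𝓝 x₀] fun x => (x - x₀) ^ n) : a = 0 := by
  by_contra ha
  have hx (x : ℝ) (hx : x ∈ ({x₀}ᶜ : Set ℝ)) : (x - x₀) ^ n • a ≠ 0 :=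
    smul_ne_zero (pow_ne_zero _ (sub_ne_zero.2 hx)) ha
  refine Asymptotics.isLittleO_irrefl (l := 𝓝[≠] x₀)
    (f'' := fun x : ℝ => (x - x₀) ^ n • a) ?_ ?_
  · exact (eventually_mem_nhdsWithin.mono hx).frequently
  · refine (h.mono nhdsWithin_le_nhds).trans_isBigO (.of_bound ‖a‖⁻¹ (.of_forall fun x => ?_))
    rw [norm_smul, mul_comm, mul_assoc, mul_inv_cancel₀ (norm_ne_zero_iff.2 ha), mul_one]

theorem isLittleO_pow_iff_iteratedDeriv_eq_zero {n : ℕ} (hφ : ContDiffAt ℝ n φ x₀) :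
    φ =o[𝓝 x₀] (fun x => (x - x₀) ^ n) ↔ ∀ k ≤ n, iteratedDeriv k φ x₀ = 0 := by
  refine ⟨fun h k => ?_, fun h => ?_⟩
  · induction k using Nat.strong_induction_on with
    | _ k ih =>
      intro hk
      have hpow : (fun x => (x - x₀) ^ n) =O[𝓝 x₀] fun x => (x - x₀) ^ k := by
        have hbdd : (fun x => (x - x₀) ^ (n - k)) =O[𝓝 x₀] fun _ => (1 : ℝ) :=
          (by fun_prop : Continuous fun x => (x - x₀) ^ (n - k)).continuousAt.isBigO_one ℝ
        simpa only [← pow_add, Nat.sub_add_cancel hk, one_mul] using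
          hbdd.mul (Asymptotics.isBigO_refl (fun x => (x - x₀) ^ k) (𝓝 x₀))
      have hterm := (h.trans_isBigO hpow).sub
        (isLittleO_sub_taylor (hφ.of_le (by exact_mod_cast hk)))
      have hlower (x : ℝ) : ∑ j ∈ Finset.range k,
          ((j.factorial : ℝ)⁻¹ * (x - x₀) ^ j) • iteratedDeriv j φ x₀ = 0 :=
        Finset.sum_eq_zero fun j hj => by
          have hj := Finset.mem_range.1 hj
          rw [ih j hj (hj.le.trans hk), smul_zero]
      have hzero : (k.factorial : ℝ)⁻¹ • iteratedDeriv k φ x₀ = 0 :=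
        eq_zero_of_pow_smul_isLittleO <| hterm.congr_left fun x => by
          rw [sub_sub_cancel, Finset.sum_range_succ, hlower, zero_add, mul_comm, mul_smul]
      exact (smul_eq_zero.1 hzero).resolve_left
        (inv_ne_zero (Nat.cast_ne_zero.2 k.factorial_ne_zero))
  · refine (isLittleO_sub_taylor hφ).congr_left fun x => ?_
    rw [Finset.sum_eq_zero fun k hk => ?_, sub_zero]
    rw [h k (Nat.lt_succ_iff.1 (Finset.mem_range.1 hk)), smul_zero]

end Taylor

theorem deriv_slice_eventuallyEq (f : 𝒜 M r) (c : Coord p q) (z : jetDomain M r) :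
    deriv (slice f.1 c z) =ᶠ[𝓝 (z.1 c)] slice (pderiv c f).1 c z := by
  filter_upwards [eventually_update_mem c z] with s hs
  rw [slice_apply _ _ _ hs]
  have hslice : slice f.1 c ⟨_, hs⟩ = slice f.1 c z := by
    funext t
    simp only [slice, Function.update_idem]
  have hderiv := hasDerivAt_slice f c ⟨_, hs⟩
  rw [hslice] at hderiv
  simpa only [Function.update_self] using hderiv.deriv

theorem iteratedDeriv_slice (k : ℕ) (f : 𝒜 M r) (c : Coord p q) (z : jetDomain M r) :
    iteratedDeriv k (slice f.1 c z) (z.1 c) = ((pderiv c)^[k] f).1 z := by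
  induction k generalizing f with
  | zero => rw [iteratedDeriv_zero, slice_self, Function.iterate_zero_apply]
  | succ k ih =>
    rw [iteratedDeriv_succ', (deriv_slice_eventuallyEq f c z).iteratedDeriv_eq, ih,
      Function.iterate_succ_apply]

theorem update_eps_zero_mem (z : jetDomain M r) : Function.update z.1 .eps 0 ∈ jetDomain M r := by
  have hr : -r < r := z.2.2.1.trans z.2.2.2
  refine ⟨by simpa [Function.update_of_ne] using z.2.1, ?_⟩
  rw [Function.update_self]
  constructor <;> linarith

theorem isSmall_iff_of_eps_eq_zero {N : ℕ} {f : 𝒜 M r} : IsSmall N f ↔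
    ∀ z : jetDomain M r, z.1 .eps = 0 → slice f.1 .eps z =o[𝓝 0] fun e : ℝ => e ^ N := by
  refine ⟨fun h z _ => h z, fun h z => ?_⟩
  have hslice : slice f.1 .eps ⟨_, update_eps_zero_mem z⟩ = slice f.1 .eps z := by
    funext t
    simp only [slice, Function.update_idem]
  exact hslice ▸ h ⟨_, update_eps_zero_mem z⟩ (Function.update_self ..)

theorem isSmall_iff_iterate_pderiv_eps {N : ℕ} {f : 𝒜 M r} : IsSmall N f ↔
    ∀ z : jetDomain M r, z.1 .eps = 0 → ∀ k ≤ N, ((pderiv .eps)^[k] f).1 z = 0 := by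
  rw [isSmall_iff_of_eps_eq_zero]
  refine forall₂_congr fun z hz => ?_
  have hsmooth : ContDiffAt ℝ N (slice f.1 .eps z) (z.1 .eps) :=
    (contDiffAt_slice f .eps z).of_le (by exact_mod_cast le_top)
  have key := isLittleO_pow_iff_iteratedDeriv_eq_zero hsmooth
  simp only [iteratedDeriv_slice] at key
  simpa only [hz, sub_zero] using key

theorem IsSmall.pderiv {N : ℕ} {f : 𝒜 M r} (h : IsSmall N f) {c : Coord p q} (hc : c ≠ .eps) :
    IsSmall N (pderiv c f) := by
  rw [isSmall_iff_iterate_pderiv_eps] at h ⊢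
  intro z hz k hk
  have hcomm : (ApproxHam.pderiv .eps)^[k] (ApproxHam.pderiv c f) =
      ApproxHam.pderiv c ((ApproxHam.pderiv .eps)^[k] f) :=
    (Function.Commute.iterate_left (fun g => pderiv_comm .eps c g) k).eq f
  rw [hcomm]
  refine pderiv_apply_eq (hasDerivAt_const _ (0 : ℝ)) fun s hs => h _ ?_ k hk
  exact (Function.update_of_ne hc.symm ..).trans hz

theorem eventually_update_eps_mem {z : jetDomain M r} (hz : z.1 .eps = 0) :
    ∀ᶠ e in 𝓝 (0 : ℝ), Function.update z.1 .eps e ∈ jetDomain M r :=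
  hz ▸ eventually_update_mem .eps z

variable (M r) in
/-- The ideal of the differential functions which are `o(ε^N)`. -/
def smallIdeal (N : ℕ) : Ideal (𝒜 M r) where
  carrier := {f | IsSmall N f}
  zero_mem' := isSmall_iff_of_eps_eq_zero.2 fun z hz =>
    (Asymptotics.isLittleO_zero _ _).congr' (by
      filter_upwards [eventually_update_eps_mem hz] with e he
      simp [slice_apply _ _ _ he]) .rfl
  add_mem' hf hg := isSmall_iff_of_eps_eq_zero.2 fun z hz =>
    ((hf z).add (hg z)).congr' (by
      filter_upwards [eventually_update_eps_mem hz] with e he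
      simp [slice_apply _ _ _ he]) .rfl
  smul_mem' g f hf := isSmall_iff_of_eps_eq_zero.2 fun z hz => by
    have hg : slice g.1 .eps z =O[𝓝 0] fun _ => (1 : ℝ) :=
      hz ▸ (contDiffAt_slice g .eps z).continuousAt.isBigO_one ℝ
    refine (hg.mul_isLittleO (hf z)).congr' ?_ (.of_eq (by simp only [one_mul]))
    filter_upwards [eventually_update_eps_mem hz] with e he
    simp [slice_apply _ _ _ he]

/-- An ideal stable under all the partial derivatives except `∂/∂ε`. Computing modulo such an ideal
treats exact identities (`⊥`) and identities up to `o(ε^N)` (`smallIdeal`) at the same time. -/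
def IsJetIdeal (I : Ideal (𝒜 M r)) : Prop :=
  ∀ c : Coord p q, c ≠ .eps → ∀ f ∈ I, pderiv c f ∈ I

theorem isJetIdeal_bot : IsJetIdeal (⊥ : Ideal (𝒜 M r)) := by
  rintro c - f rfl
  exact (partialD c).map_zero

theorem isJetIdeal_smallIdeal (N : ℕ) : IsJetIdeal (smallIdeal M r N) :=
  fun _ hc _ hf => IsSmall.pderiv hf hc

section IsJetIdeal

variable {I : Ideal (𝒜 M r)}

theorem IsJetIdeal.vectorField_mem (hI : IsJetIdeal I) {v : Coord p q → 𝒜 M r}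
    (hv : v .eps = 0) {f : 𝒜 M r} (hf : f ∈ I) : vectorField v f ∈ I := by
  rw [vectorField_eq_sum subset_rfl]
  refine I.sum_mem fun c _ => ?_
  by_cases hc : c = .eps
  · simp [hc, hv]
  · exact I.mul_mem_right _ (hI c hc f hf)

theorem IsJetIdeal.totalD_mem (hI : IsJetIdeal I) (i : Fin p) {f : 𝒜 M r} (hf : f ∈ I) :
    totalD i f ∈ I := hI.vectorField_mem rfl hf

theorem IsJetIdeal.adjDJ_mem (hI : IsJetIdeal I) (J : MultiIndex p) {f : 𝒜 M r} (hf : f ∈ I) :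
    adjDJ J f ∈ I := by
  induction J using MultiIndex.induction with
  | zero => rwa [adjDJ_zero]
  | add_single i J ih => rw [adjDJ_add_single]; exact I.neg_mem (hI.totalD_mem i ih)

end IsJetIdeal

/-! ### Scalar differential operators -/

variable (M r) in
/-- The coefficients `(P_J)_J` of a scalar differential operator `∑_J P_J D_J`. -/
abbrev Symbol : Type := MultiIndex p →₀ 𝒜 M r

/-- The differential operator `f ↦ ∑_J a_J D_J f`. -/
def diffOp : Symbol M r →ₗ[ℝ] 𝒜 M r →ₗ[ℝ] 𝒜 M r :=
  Finsupp.lsum ℝ fun J => (LinearMap.mul ℝ (𝒜 M r)).compl₂ (totalDJ J)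

/-- The formal adjoint `f ↦ ∑_J (-D)_J (a_J f)` of `diffOp a`. -/
def adjOp : Symbol M r →ₗ[ℝ] 𝒜 M r →ₗ[ℝ] 𝒜 M r :=
  Finsupp.lsum ℝ fun J => (LinearMap.mul ℝ (𝒜 M r)).compr₂ (adjDJ J)

theorem diffOp_single (J : MultiIndex p) (c f : 𝒜 M r) :
    diffOp (Finsupp.single J c) f = c * totalDJ J f := by
  rw [diffOp, Finsupp.lsum_single, LinearMap.compl₂_apply, LinearMap.mul_apply']

theorem adjOp_single (J : MultiIndex p) (c f : 𝒜 M r) :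
    adjOp (Finsupp.single J c) f = adjDJ J (c * f) := by
  rw [adjOp, Finsupp.lsum_single, LinearMap.compr₂_apply, LinearMap.mul_apply']

theorem diffOp_apply (a : Symbol M r) (f : 𝒜 M r) :
    diffOp a f = a.sum fun J c => c * totalDJ J f := by
  rw [diffOp, Finsupp.lsum_apply, LinearMap.finsupp_sum_apply]
  rfl

theorem adjOp_apply (a : Symbol M r) (f : 𝒜 M r) :
    adjOp a f = a.sum fun J c => adjDJ J (c * f) := by
  rw [adjOp, Finsupp.lsum_apply, LinearMap.finsupp_sum_apply]
  rfl

theorem adjOp_smul (g : 𝒜 M r) (a : Symbol M r) (f : 𝒜 M r) :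
    adjOp (g • a) f = adjOp a (g * f) := by
  induction a using Finsupp.induction_linear with
  | zero => simp
  | add a b ha hb => rw [smul_add, map_add, map_add, LinearMap.add_apply, ha, hb,
      LinearMap.add_apply]
  | single J c => rw [Finsupp.smul_single, adjOp_single, adjOp_single, smul_eq_mul, mul_comm g,
      mul_assoc]

/-- The symbol of the composition `D_i ∘ ∑_J a_J D_J`. -/
def symbolTotalD (i : Fin p) : Module.End ℝ (Symbol M r) :=
  Finsupp.mapRange.linearMap (totalD i).toLinearMap +
    Finsupp.lmapDomain (𝒜 M r) ℝ (· + Finsupp.single i 1)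

theorem symbolTotalD_single (i : Fin p) (J : MultiIndex p) (c : 𝒜 M r) :
    symbolTotalD i (Finsupp.single J c) =
      Finsupp.single J (totalD i c) + Finsupp.single (J + Finsupp.single i 1) c := by
  simp [symbolTotalD]

theorem symbolTotalD_comm (i j : Fin p) (a : Symbol M r) :
    symbolTotalD i (symbolTotalD j a) = symbolTotalD j (symbolTotalD i a) := by
  induction a using Finsupp.induction_linear with
  | zero => simp
  | add a b ha hb => simp only [map_add, ha, hb]
  | single J c =>
    simp only [symbolTotalD_single, map_add, totalD_comm j i, add_right_comm J]
    abel

theorem diffOp_symbolTotalD (i : Fin p) (a : Symbol M r) (f : 𝒜 M r) :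
    diffOp (symbolTotalD i a) f = totalD i (diffOp a f) := by
  induction a using Finsupp.induction_linear with
  | zero => simp
  | add a b ha hb => simp only [map_add, LinearMap.add_apply, ha, hb]
  | single J c =>
    rw [symbolTotalD_single, map_add, LinearMap.add_apply, diffOp_single, diffOp_single,
      diffOp_single, Derivation.leibniz, totalDJ_add_single, smul_eq_mul, smul_eq_mul]
    ring

theorem adjOp_symbolTotalD (i : Fin p) (a : Symbol M r) (f : 𝒜 M r) :
    adjOp (symbolTotalD i a) f = -adjOp a (totalD i f) := by
  induction a using Finsupp.induction_linear with
  | zero => simp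
  | add a b ha hb => simp only [map_add, LinearMap.add_apply, ha, hb, neg_add]
  | single J c =>
    rw [symbolTotalD_single, map_add, LinearMap.add_apply, adjOp_single, adjOp_single,
      adjOp_single, adjDJ_add_single, ← adjDJ_totalD, Derivation.leibniz, map_add, smul_eq_mul,
      smul_eq_mul, mul_comm f]
    abel

/-- The symbol of the formal adjoint of `diffOp a`. -/
def formalAdjoint : Module.End ℝ (Symbol M r) :=
  Finsupp.lsum ℝ fun J =>
    ((List.finRange p).map fun i =>
      (-symbolTotalD i : Module.End ℝ (Symbol M r)) ^ J i).prod ∘ₗ Finsupp.lsingle 0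

theorem formalAdjoint_single (J : MultiIndex p) (c : 𝒜 M r) :
    formalAdjoint (Finsupp.single J c) =
      iterOp (fun i => (-symbolTotalD i : Module.End ℝ (Symbol M r))) J
        (Finsupp.single 0 c) := by
  rw [formalAdjoint, Finsupp.lsum_single, iterOp_linearMap]
  rfl

theorem formalAdjoint_single_zero (c : 𝒜 M r) :
    formalAdjoint (Finsupp.single 0 c) = Finsupp.single 0 c := by
  rw [formalAdjoint_single, iterOp_zero]

theorem formalAdjoint_single_add_single (J : MultiIndex p) (i : Fin p) (c : 𝒜 M r) :
    formalAdjoint (Finsupp.single (J + Finsupp.single i 1) c) =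
      -symbolTotalD i (formalAdjoint (Finsupp.single J c)) := by
  rw [formalAdjoint_single, iterOp_add_single, ← formalAdjoint_single]
  · rfl
  · intro i j a
    simp only [LinearMap.neg_apply, map_neg, symbolTotalD_comm i]

theorem diffOp_formalAdjoint (a : Symbol M r) (f : 𝒜 M r) :
    diffOp (formalAdjoint a) f = adjOp a f := by
  induction a using Finsupp.induction_linear with
  | zero => simp
  | add a b ha hb => simp only [map_add, LinearMap.add_apply, ha, hb]
  | single J c =>
    rw [adjOp_single]
    induction J using MultiIndex.induction with
    | zero => rw [formalAdjoint_single_zero, diffOp_single, totalDJ_zero, adjDJ_zero]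
    | add_single i J ih =>
      rw [formalAdjoint_single_add_single, map_neg, LinearMap.neg_apply, diffOp_symbolTotalD, ih,
        adjDJ_add_single]

theorem adjOp_formalAdjoint (a : Symbol M r) (f : 𝒜 M r) :
    adjOp (formalAdjoint a) f = diffOp a f := by
  induction a using Finsupp.induction_linear with
  | zero => simp
  | add a b ha hb => simp only [map_add, LinearMap.add_apply, ha, hb]
  | single J c =>
    rw [diffOp_single]
    induction J using MultiIndex.induction generalizing f with
    | zero => rw [formalAdjoint_single_zero, adjOp_single, totalDJ_zero, adjDJ_zero]
    | add_single i J ih =>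
      rw [formalAdjoint_single_add_single, map_neg, LinearMap.neg_apply, adjOp_symbolTotalD,
        neg_neg, ih, totalDJ_totalD, totalDJ_add_single]

theorem IsJetIdeal.symbolTotalD_mem {I : Ideal (𝒜 M r)} (hI : IsJetIdeal I) (i : Fin p)
    {a : Symbol M r} (ha : ∀ J, a J ∈ I) (J : MultiIndex p) : symbolTotalD i a J ∈ I := by
  have hadd (J : MultiIndex p) {b b' : Symbol M r} (h : b J ∈ I) (h' : b' J ∈ I) :
      (b + b') J ∈ I := I.add_mem h h'
  have hsingle {c : 𝒜 M r} (hc : c ∈ I) (K : MultiIndex p) : Finsupp.single K c J ∈ I := by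
    rw [Finsupp.single_apply]
    split_ifs
    exacts [hc, I.zero_mem]
  rw [← a.sum_single, map_finsuppSum, Finsupp.sum_apply]
  refine I.sum_mem fun K _ => ?_
  simp only [symbolTotalD_single]
  exact hadd J (hsingle (hI.totalD_mem i (ha K)) K) (hsingle (ha K) _)

theorem IsJetIdeal.formalAdjoint_mem {I : Ideal (𝒜 M r)} (hI : IsJetIdeal I)
    {a : Symbol M r} (ha : ∀ J, a J ∈ I) (J : MultiIndex p) : formalAdjoint a J ∈ I := by
  have hsingle {c : 𝒜 M r} (hc : c ∈ I) (K : MultiIndex p) :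
      ∀ J, formalAdjoint (Finsupp.single K c) J ∈ I := by
    induction K using MultiIndex.induction with
    | zero =>
      rw [formalAdjoint_single_zero]
      intro J
      rw [Finsupp.single_apply]
      split_ifs
      exacts [hc, I.zero_mem]
    | add_single i K ih =>
      rw [formalAdjoint_single_add_single]
      exact fun J => I.neg_mem (hI.symbolTotalD_mem i ih J)
  rw [← a.sum_single, map_finsuppSum, Finsupp.sum_apply]
  exact I.sum_mem fun K _ => hsingle (ha K) K J

theorem totalDJ_x_mul (J : MultiIndex p) (i : Fin p) (f : 𝒜 M r) :
    totalDJ J (coordFun (.x i) * f) =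
      coordFun (.x i) * totalDJ J f + (J i : ℝ) • totalDJ (J - Finsupp.single i 1) f := by
  induction J using MultiIndex.induction with
  | zero => simp [totalDJ_zero]
  | add_single j J ih =>
    rw [totalDJ_add_single, ih, map_add, Derivation.leibniz, Derivation.map_smul, totalD_x,
      smul_eq_mul, smul_eq_mul, ← totalDJ_add_single, ← totalDJ_add_single, add_assoc]
    congr 1
    by_cases h : i = j
    · subst h
      rcases Nat.eq_zero_or_pos (J i) with h0 | h0
      · simp [h0]
      · have : J - Finsupp.single i 1 + Finsupp.single i 1 = J :=
          tsub_add_cancel_of_le (Finsupp.single_le_iff.2 h0)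
        rw [this, add_tsub_cancel_right, Finsupp.add_apply, Finsupp.single_eq_same]
        simp only [if_pos, mul_one, Nat.cast_add, Nat.cast_one]
        module
    · have h1 : (J + Finsupp.single j 1 : MultiIndex p) i = J i := by
        simp [Ne.symm h]
      have h2 : J + Finsupp.single j 1 - Finsupp.single i 1 =
          J - Finsupp.single i 1 + Finsupp.single j 1 := by
        ext k
        simp only [Finsupp.add_apply, Finsupp.tsub_apply, Finsupp.single_apply]
        lia
      rw [if_neg h, mul_zero, zero_add, h1, h2]

/-- The symbol of the commutator of `diffOp a` with the multiplication by `x^i`. -/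
def symbolDeriv (i : Fin p) : Module.End ℝ (Symbol M r) :=
  Finsupp.lsum ℝ fun J => (J i : ℝ) • Finsupp.lsingle (J - Finsupp.single i 1)

theorem symbolDeriv_single (i : Fin p) (J : MultiIndex p) (c : 𝒜 M r) :
    symbolDeriv i (Finsupp.single J c) = (J i : ℝ) • Finsupp.single (J - Finsupp.single i 1) c := by
  rw [symbolDeriv, Finsupp.lsum_single]
  rfl

theorem symbolDeriv_apply (i : Fin p) (a : Symbol M r) (J : MultiIndex p) :
    symbolDeriv i a J = (J i + 1 : ℝ) • a (J + Finsupp.single i 1) := by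
  induction a using Finsupp.induction_linear with
  | zero => simp
  | add a b ha hb => rw [map_add, Finsupp.add_apply, ha, hb, ← smul_add, Finsupp.add_apply]
  | single K c =>
    rw [symbolDeriv_single, Finsupp.smul_apply]
    by_cases h : K = J + Finsupp.single i 1
    · simp [h]
    · rw [Finsupp.single_eq_of_ne' h, smul_zero]
      rcases Nat.eq_zero_or_pos (K i) with h0 | h0
      · simp [h0]
      · rw [Finsupp.single_eq_of_ne', smul_zero]
        rintro rfl
        exact h (tsub_add_cancel_of_le (Finsupp.single_le_iff.2 h0)).symm

theorem diffOp_x_mul (a : Symbol M r) (i : Fin p) (f : 𝒜 M r) :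
    diffOp a (coordFun (.x i) * f) = coordFun (.x i) * diffOp a f + diffOp (symbolDeriv i a) f := by
  induction a using Finsupp.induction_linear with
  | zero => simp
  | add a b ha hb => simp only [map_add, LinearMap.add_apply, ha, hb]; ring
  | single J c =>
    rw [symbolDeriv_single, map_smul, LinearMap.smul_apply, diffOp_single, diffOp_single,
      diffOp_single, totalDJ_x_mul, mul_add, mul_smul_comm, mul_left_comm]

theorem diffOp_one (a : Symbol M r) : diffOp a 1 = a 0 := by
  induction a using Finsupp.induction_linear with
  | zero => simp
  | add a b ha hb => rw [map_add, LinearMap.add_apply, ha, hb, Finsupp.add_apply]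
  | single J c =>
    rw [diffOp_single]
    induction J using MultiIndex.induction with
    | zero => simp [totalDJ_zero]
    | add_single i J _ => simp [totalDJ_add_single, ← totalDJ_totalD]

/-- Differential functions which do not depend on the jet variables. -/
def IsBaseFunction (f : 𝒜 M r) : Prop := jetGradient f = 0

theorem isBaseFunction_one : IsBaseFunction (1 : 𝒜 M r) := jetGradient.map_one_eq_zero

theorem IsBaseFunction.x_mul {f : 𝒜 M r} (hf : IsBaseFunction f) (i : Fin p) :
    IsBaseFunction (coordFun (.x i) * f) := by
  rw [IsBaseFunction] at hf ⊢
  rw [Derivation.leibniz, hf, jetGradient_coordFun_x, smul_zero, smul_zero, add_zero]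

theorem coeff_mem_of_diffOp_mem {I : Ideal (𝒜 M r)} {a : Symbol M r}
    (ha : ∀ φ, IsBaseFunction φ → diffOp a φ ∈ I) (J : MultiIndex p) : a J ∈ I := by
  induction J using MultiIndex.induction generalizing a with
  | zero => rw [← diffOp_one]; exact ha 1 isBaseFunction_one
  | add_single i J ih =>
    have hmem : (J i + 1 : ℝ) • a (J + Finsupp.single i 1) ∈ I := by
      rw [← symbolDeriv_apply]
      refine ih fun φ hφ => ?_
      rw [← add_sub_cancel_left (coordFun (.x i) * diffOp a φ) (diffOp _ φ), ← diffOp_x_mul]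
      exact I.sub_mem (ha _ (hφ.x_mul i)) (I.mul_mem_left _ (ha φ hφ))
    have := I.smul_of_tower_mem (J i + 1 : ℝ)⁻¹ hmem
    rwa [inv_smul_smul₀ (by positivity)] at this

theorem symbol_ext {a b : Symbol M r} (h : ∀ φ, IsBaseFunction φ → diffOp a φ = diffOp b φ) :
    a = b := by
  refine sub_eq_zero.1 (Finsupp.ext fun J => coeff_mem_of_diffOp_mem (I := ⊥) (fun φ hφ => ?_) J)
  rw [map_sub, LinearMap.sub_apply, h φ hφ, sub_self]
  exact zero_mem _

theorem IsJetIdeal.coeff_mem_of_adjOp_mem {I : Ideal (𝒜 M r)} (hI : IsJetIdeal I)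
    {a : Symbol M r} (ha : ∀ φ, IsBaseFunction φ → adjOp a φ ∈ I) (J : MultiIndex p) :
    a J ∈ I := by
  have hinv : formalAdjoint (formalAdjoint a) = a := symbol_ext fun φ _ => by
    rw [diffOp_formalAdjoint, adjOp_formalAdjoint]
  rw [← hinv]
  refine hI.formalAdjoint_mem (coeff_mem_of_diffOp_mem fun φ hφ => ?_) J
  rw [diffOp_formalAdjoint]
  exact ha φ hφ

/-! ### Functionals -/

/-- The total divergence, as a linear map. -/
def divergenceₗ : (Fin p → 𝒜 M r) →ₗ[ℝ] 𝒜 M r :=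
  ∑ i, (totalD i).toLinearMap ∘ₗ LinearMap.proj i

theorem divergenceₗ_apply (X : Fin p → 𝒜 M r) : divergenceₗ X = ∑ i, totalD i (X i) := by
  rw [divergenceₗ, LinearMap.sum_apply]
  rfl

theorem divergence_eq_divergenceₗ (X : Fin p → 𝒜 M r) : divergence X = divergenceₗ X := by
  rw [divergenceₗ_apply, divergence, totalDeriv_eq_totalD]

theorem map_divergenceₗ {φ : 𝒜 M r →ₗ[ℝ] 𝒜 M r} (h : ∀ i f, φ (totalD i f) = totalD i (φ f))
    (X : Fin p → 𝒜 M r) : φ (divergenceₗ X) = divergenceₗ fun i => φ (X i) := by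
  simp only [divergenceₗ_apply, map_sum, h]

/-- The densities of the functionals which vanish modulo the ideal `I`. -/
def nullDensities (I : Ideal (𝒜 M r)) : Submodule ℝ (𝒜 M r) :=
  LinearMap.range divergenceₗ ⊔ I.restrictScalars ℝ

/-- The functional with a given density, modulo total divergences and the ideal `I`. -/
def integral (I : Ideal (𝒜 M r)) : 𝒜 M r →ₗ[ℝ] 𝒜 M r ⧸ nullDensities I := (nullDensities I).mkQ

section Integral

variable {I : Ideal (𝒜 M r)}

theorem integral_eq_zero_iff {L : 𝒜 M r} :
    integral I L = 0 ↔ ∃ X : Fin p → 𝒜 M r, L - divergenceₗ X ∈ I := by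
  rw [integral, Submodule.mkQ_apply, Submodule.Quotient.mk_eq_zero, nullDensities,
    Submodule.mem_sup]
  constructor
  · rintro ⟨-, ⟨X, rfl⟩, f, hf, rfl⟩
    exact ⟨X, by rwa [add_sub_cancel_left]⟩
  · rintro ⟨X, hX⟩
    exact ⟨_, ⟨X, rfl⟩, _, hX, add_sub_cancel _ _⟩

theorem integralZero_iff {L : 𝒜 M r} : IntegralZero L ↔ integral ⊥ L = 0 := by
  simp only [IntegralZero, divergence_eq_divergenceₗ, integral_eq_zero_iff, Ideal.mem_bot,
    sub_eq_zero]

theorem integralSmall_iff {N : ℕ} {L : 𝒜 M r} :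
    IntegralSmall N L ↔ integral (smallIdeal M r N) L = 0 := by
  simp only [IntegralSmall, divergence_eq_divergenceₗ, integral_eq_zero_iff]
  rfl

theorem integral_eq_zero_mono {J : Ideal (𝒜 M r)} (hIJ : I ≤ J) {L : 𝒜 M r}
    (h : integral I L = 0) : integral J L = 0 :=
  let ⟨X, hX⟩ := integral_eq_zero_iff.1 h
  integral_eq_zero_iff.2 ⟨X, hIJ hX⟩

theorem integral_of_mem {L : 𝒜 M r} (h : L ∈ I) : integral I L = 0 :=
  integral_eq_zero_iff.2 ⟨0, by rwa [map_zero, sub_zero]⟩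

theorem integral_totalD (i : Fin p) (f : 𝒜 M r) : integral I (totalD i f) = 0 := by
  refine integral_eq_zero_iff.2 ⟨Pi.single i f, ?_⟩
  rw [divergenceₗ_apply, Finset.sum_eq_single_of_mem i (Finset.mem_univ i) fun j _ hj => by
    rw [Pi.single_eq_of_ne hj, map_zero], Pi.single_eq_same, sub_self]
  exact I.zero_mem

theorem integral_totalD_mul (i : Fin p) (f g : 𝒜 M r) :
    integral I (totalD i f * g) = -integral I (f * totalD i g) := by
  rw [eq_neg_iff_add_eq_zero, ← map_add, add_comm, mul_comm _ g]
  exact (congrArg _ ((totalD i).leibniz f g).symm).trans (integral_totalD i (f * g))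

theorem integral_totalDJ_mul (J : MultiIndex p) (f g : 𝒜 M r) :
    integral I (totalDJ J f * g) = integral I (f * adjDJ J g) := by
  induction J using MultiIndex.induction generalizing g with
  | zero => rw [totalDJ_zero, adjDJ_zero]
  | add_single i J ih =>
    rw [totalDJ_add_single, integral_totalD_mul, ih, adjDJ_add_single, adjDJ_totalD, ← map_neg]
    congr 1
    ring

theorem integral_mul_diffOp (a : Symbol M r) (f g : 𝒜 M r) :
    integral I (g * diffOp a f) = integral I (f * adjOp a g) := by
  induction a using Finsupp.induction_linear with
  | zero => simp
  | add a b ha hb => simp only [map_add, LinearMap.add_apply, mul_add, ha, hb]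
  | single J c =>
    rw [diffOp_single, adjOp_single, ← integral_totalDJ_mul]
    congr 1
    ring

end Integral

/-! ### Evolutionary vector fields and the Euler operator -/

/-- The part `(g (α, J))_J` of a jet covector `g` which belongs to the variable `u^α`. -/
def jetComponent (α : Fin q) : (Lab p q →₀ 𝒜 M r) →ₗ[𝒜 M r] Symbol M r :=
  Finsupp.lcomapDomain (Prod.mk α) (Prod.mk_right_injective α)

theorem jetComponent_single (α β : Fin q) (J : MultiIndex p) (f : 𝒜 M r) :
    jetComponent α (Finsupp.single (β, J) f) = if β = α then Finsupp.single J f else 0 := by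
  ext1 K
  change Finsupp.single (β, J) f (α, K) = _
  split_ifs with h
  · subst h
    simp [Finsupp.single_apply]
  · rw [Finsupp.single_eq_of_ne fun e => h (congrArg Prod.fst e).symm, Finsupp.zero_apply]

theorem linearCombination_totalDJ (V : Fin q → 𝒜 M r) (g : Lab p q →₀ 𝒜 M r) :
    Finsupp.linearCombination (𝒜 M r) (fun c => totalDJ c.2 (V c.1)) g =
      ∑ α, diffOp (jetComponent α g) (V α) := by
  induction g using Finsupp.induction_linear with
  | zero => simp
  | add g h hg hh => simp only [map_add, LinearMap.add_apply, Finset.sum_add_distrib, hg, hh]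
  | single c f =>
    obtain ⟨β, J⟩ := c
    rw [Finset.sum_eq_single_of_mem β (Finset.mem_univ β) fun α _ hα => by
      rw [jetComponent_single, if_neg hα.symm, map_zero, LinearMap.zero_apply],
      jetComponent_single, if_pos rfl, diffOp_single, Finsupp.linearCombination_single,
      smul_eq_mul]

/-- The symbol `(∂f/∂u^α_J)_J` of the Fréchet derivative of `f` with respect to `u^α`. -/
def frechet (α : Fin q) : Derivation ℝ (𝒜 M r) (Symbol M r) := (jetComponent α).compDer jetGradient

/-- The prolonged evolutionary vector field `pr v_V = ∑_{α,J} D_J V_α ∂/∂u^α_J`. -/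
def prEv (V : Fin q → 𝒜 M r) : Derivation ℝ (𝒜 M r) (𝒜 M r) :=
  vectorField (verticalCoeff fun c => totalDJ c.2 (V c.1))

theorem prEv_apply (V : Fin q → 𝒜 M r) (f : 𝒜 M r) :
    prEv V f = ∑ α, diffOp (frechet α f) (V α) :=
  (vectorField_verticalCoeff _ f).trans (linearCombination_totalDJ V _)

theorem prEv_totalD (V : Fin q → 𝒜 M r) (i : Fin p) (f : 𝒜 M r) :
    prEv V (totalD i f) = totalD i (prEv V f) := by
  refine vectorField_comm (fun c => ?_) f
  cases c with
  | x j => simp only [totalCoeff, verticalCoeff]; split_ifs <;> simp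
  | u α J =>
    refine (vectorField_coordFun _ _).trans ?_
    exact totalDJ_add_single J i (V α)
  | eps => simp [totalCoeff, verticalCoeff]

theorem prEv_totalDJ (V : Fin q → 𝒜 M r) (J : MultiIndex p) (f : 𝒜 M r) :
    prEv V (totalDJ J f) = totalDJ J (prEv V f) := map_totalDJ (prEv_totalD V) J f

theorem prEv_commutator (V W : Fin q → 𝒜 M r) :
    ⁅prEv V, prEv W⁆ = prEv (prEv V ∘ W - prEv W ∘ V) := by
  refine (vectorField_commutator _ _).trans (congrArg vectorField (funext fun c => ?_))
  cases c with
  | x j => simp [verticalCoeff]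
  | u α J =>
    refine Eq.trans ?_ (map_sub (totalDJ J) _ _).symm
    exact congrArg₂ _ (prEv_totalDJ V J (W α)) (prEv_totalDJ W J (V α))
  | eps => simp [verticalCoeff]

theorem frechet_totalD (α : Fin q) (i : Fin p) (f : 𝒜 M r) :
    frechet α (totalD i f) = symbolTotalD i (frechet α f) := by
  have hprEv (φ g : 𝒜 M r) : diffOp (frechet α g) φ = prEv (Pi.single α φ) g := by
    rw [prEv_apply, Finset.sum_eq_single_of_mem α (Finset.mem_univ α) fun β _ hβ => by
      rw [Pi.single_eq_of_ne hβ, map_zero], Pi.single_eq_same]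
  refine symbol_ext fun φ _ => ?_
  rw [diffOp_symbolTotalD, hprEv, hprEv, prEv_totalD]

theorem euler_eq_adjOp (L : 𝒜 M r) (α : Fin q) : euler L α = adjOp (frechet α L) 1 := by
  have hterm (J : MultiIndex p) : (-1 : 𝒜 M r) ^ J.degree *
      iterOp totalDeriv J (pderiv (.u α J) L) = adjDJ J (frechet α L J * 1) := by
    have hsign : (-1 : 𝒜 M r) ^ J.degree = algebraMap ℝ _ ((-1) ^ J.degree) := by simp
    rw [iterOp_totalDeriv, mul_one, hsign, ← Algebra.smul_def]
    rfl
  simp only [euler, hterm]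
  rw [adjOp_apply]
  refine finsum_eq_finsetSum_of_support_subset _ fun J => ?_
  rw [Finset.mem_coe, Finsupp.mem_support_iff]
  exact mt fun h => by simp only [h, zero_mul, map_zero]

theorem euler_totalD (i : Fin p) (f : 𝒜 M r) : euler (totalD i f) = 0 := by
  ext1 α
  rw [euler_eq_adjOp, frechet_totalD, adjOp_symbolTotalD, Derivation.map_one_eq_zero, map_zero,
    neg_zero, Pi.zero_apply]

/-- The Euler operator, as a linear map. -/
def eulerₗ (α : Fin q) : 𝒜 M r →ₗ[ℝ] 𝒜 M r :=
  LinearMap.applyₗ (1 : 𝒜 M r) ∘ₗ adjOp ∘ₗ (frechet α).toLinearMap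

theorem eulerₗ_apply (α : Fin q) (L : 𝒜 M r) : eulerₗ α L = euler L α :=
  (euler_eq_adjOp L α).symm

theorem euler_divergenceₗ (X : Fin p → 𝒜 M r) : euler (divergenceₗ X) = 0 := by
  ext1 α
  simp only [← eulerₗ_apply, divergenceₗ_apply, map_sum]
  simp only [eulerₗ_apply, euler_totalD, Pi.zero_apply, Finset.sum_const_zero]

section IsJetIdeal

variable {I : Ideal (𝒜 M r)}

theorem IsJetIdeal.prEv_mem (hI : IsJetIdeal I) (V : Fin q → 𝒜 M r) {f : 𝒜 M r} (hf : f ∈ I) :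
    prEv V f ∈ I := hI.vectorField_mem rfl hf

theorem IsJetIdeal.integral_prEv (hI : IsJetIdeal I) (V : Fin q → 𝒜 M r) {f : 𝒜 M r}
    (hf : integral I f = 0) : integral I (prEv V f) = 0 := by
  obtain ⟨X, hX⟩ := integral_eq_zero_iff.1 hf
  refine integral_eq_zero_iff.2 ⟨fun i => prEv V (X i), ?_⟩
  rw [← Derivation.coeFn_coe, ← map_divergenceₗ (prEv_totalD V), ← map_sub]
  exact hI.prEv_mem V hX

theorem IsJetIdeal.euler_mem (hI : IsJetIdeal I) {L : 𝒜 M r} (hL : integral I L = 0)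
    (α : Fin q) : euler L α ∈ I := by
  obtain ⟨X, hX⟩ := integral_eq_zero_iff.1 hL
  have hLX : euler L α = euler (L - divergenceₗ X) α := by
    rw [← eulerₗ_apply, ← eulerₗ_apply, map_sub, eulerₗ_apply _ (divergenceₗ X), euler_divergenceₗ,
      Pi.zero_apply, sub_zero]
  rw [hLX, euler_eq_adjOp, adjOp_apply]
  exact I.sum_mem fun J _ => hI.adjDJ_mem J (I.mul_mem_right _ (hI (.u α J) nofun _ hX))

theorem derivation_dotProduct (v : Derivation ℝ (𝒜 M r) (𝒜 M r)) (P Q : Fin q → 𝒜 M r) :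
    v (P ⬝ᵥ Q) = (v ∘ P) ⬝ᵥ Q + P ⬝ᵥ (v ∘ Q) := by
  simp only [dotProduct, map_sum, Derivation.leibniz, smul_eq_mul, ← Finset.sum_add_distrib,
    Function.comp_apply]
  exact Finset.sum_congr rfl fun α _ => by rw [add_comm, mul_comm (Q α)]

theorem integral_dotProduct_euler (V : Fin q → 𝒜 M r) (L : 𝒜 M r) :
    integral I (V ⬝ᵥ euler L) = integral I (prEv V L) := by
  simp only [dotProduct, prEv_apply, map_sum, euler_eq_adjOp, ← integral_mul_diffOp, one_mul]

/-- The Fréchet derivative of a variational derivative is self-adjoint: up to terms which are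
symmetric in `V` and `W`, both sides are `∫ pr v_V (pr v_W L) dx`. -/
theorem IsJetIdeal.integral_dotProduct_prEv_euler (hI : IsJetIdeal I) (V W : Fin q → 𝒜 M r)
    (L : 𝒜 M r) :
    integral I (W ⬝ᵥ (prEv V ∘ euler L)) = integral I (V ⬝ᵥ (prEv W ∘ euler L)) := by
  have second_variation (V W : Fin q → 𝒜 M r) : integral I (prEv V (prEv W L)) =
      integral I ((prEv V ∘ W) ⬝ᵥ euler L) + integral I (W ⬝ᵥ (prEv V ∘ euler L)) := by
    have h : integral I (prEv W L - W ⬝ᵥ euler L) = 0 := by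
      rw [map_sub, integral_dotProduct_euler, sub_self]
    have h' := hI.integral_prEv V h
    rwa [map_sub, map_sub, sub_eq_zero, derivation_dotProduct, map_add] at h'
  have h := congrArg (integral I) (DFunLike.congr_fun (prEv_commutator V W) L)
  rw [Derivation.commutator_apply, map_sub, second_variation V W, second_variation W V,
    ← integral_dotProduct_euler, sub_dotProduct, map_sub] at h
  linear_combination (norm := module) h

end IsJetIdeal

/-! ### The fundamental lemma of the calculus of variations -/

theorem euler_eq_single_of_jetGradient_eq_single {L f : 𝒜 M r} {α : Fin q}
    (h : jetGradient L = Finsupp.single (α, 0) f) : euler L = Pi.single α f := by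
  ext1 β
  have hβ : frechet β L = jetComponent β (Finsupp.single (α, 0) f) := congrArg (jetComponent β) h
  rw [euler_eq_adjOp, hβ, jetComponent_single]
  split_ifs with hαβ
  · rw [adjOp_single, adjDJ_zero, mul_one, hαβ, Pi.single_eq_same]
  · rw [map_zero, LinearMap.zero_apply, Pi.single_eq_of_ne' hαβ]

theorem IsBaseFunction.jetGradient_mul {φ : 𝒜 M r} (hφ : IsBaseFunction φ) (f : 𝒜 M r) :
    jetGradient (φ * f) = φ • jetGradient f := by
  rw [Derivation.leibniz, hφ, smul_zero, add_zero]

theorem IsBaseFunction.euler_mul_u {φ : 𝒜 M r} (hφ : IsBaseFunction φ) (α : Fin q) :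
    euler (φ * coordFun (.u α 0)) = Pi.single α φ := by
  refine euler_eq_single_of_jetGradient_eq_single ((hφ.jetGradient_mul _).trans ?_)
  refine (congrArg (φ • ·) (jetGradient_coordFun_u (α, 0))).trans ?_
  simp

theorem IsBaseFunction.euler_half_mul_u_sq {φ : 𝒜 M r} (hφ : IsBaseFunction φ) (α : Fin q) :
    euler ((1 / 2 : ℝ) • (φ * coordFun (.u α 0) ^ 2)) =
      Pi.single α (φ * coordFun (.u α 0)) := by
  refine euler_eq_single_of_jetGradient_eq_single ?_
  have hu : jetGradient (coordFun (.u α 0) : 𝒜 M r) = Finsupp.single (α, 0) 1 :=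
    jetGradient_coordFun_u (α, 0)
  rw [Derivation.map_smul, hφ.jetGradient_mul, pow_two, Derivation.leibniz, hu,
    Finsupp.smul_single, ← Finsupp.single_add, Finsupp.smul_single, Finsupp.smul_single,
    smul_eq_mul, smul_eq_mul, mul_one, mul_add]
  congr 1
  module

theorem IsBaseFunction.euler_mul {φ : 𝒜 M r} (hφ : IsBaseFunction φ) (f : 𝒜 M r) (α : Fin q) :
    euler (φ * f) α = adjOp (frechet α f) φ := by
  have h : frechet α (φ * f) = φ • frechet α f :=
    (congrArg (jetComponent α) (hφ.jetGradient_mul f)).trans (map_smul _ _ _)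
  rw [euler_eq_adjOp, h, adjOp_smul, mul_one]

theorem IsJetIdeal.pderiv_mem_of_integral_mul {I : Ideal (𝒜 M r)} (hI : IsJetIdeal I) {f : 𝒜 M r}
    (hf : ∀ φ, IsBaseFunction φ → integral I (φ * f) = 0) (α : Fin q) (J : MultiIndex p) :
    pderiv (.u α J) f ∈ I := by
  refine hI.coeff_mem_of_adjOp_mem (a := frechet α f) (fun φ hφ => ?_) J
  rw [← hφ.euler_mul]
  exact hI.euler_mem (hf φ hφ) α

/-- The proof uses the test functions `φ(x)` and `φ(x) u^α`, which are variational derivatives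
of `φ u^α` and `½ φ (u^α)²`. -/
theorem IsJetIdeal.mem_of_integral_mul {I : Ideal (𝒜 M r)} (hI : IsJetIdeal I) {f : 𝒜 M r}
    {α : Fin q} (hf : ∀ L ψ, euler L = Pi.single α ψ → integral I (ψ * f) = 0) : f ∈ I := by
  have hf' : pderiv (.u α 0) f ∈ I := hI.pderiv_mem_of_integral_mul
    (fun φ hφ => hf _ φ (hφ.euler_mul_u α)) α 0
  have huf : pderiv (.u α 0) (coordFun (.u α 0) * f) ∈ I := hI.pderiv_mem_of_integral_mul
    (fun φ hφ => by rw [← mul_assoc]; exact hf _ _ (hφ.euler_half_mul_u_sq α)) α 0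
  have hleibniz : pderiv (.u α 0) (coordFun (.u α 0) * f) =
      coordFun (.u α 0) * pderiv (.u α 0) f + f := by
    refine ((partialD (.u α 0)).leibniz _ _).trans (congrArg _ ?_)
    refine (congrArg (f • ·) (pderiv_coordFun _ _)).trans ?_
    simp
  rw [hleibniz] at huf
  exact (I.add_mem_iff_right (I.mul_mem_left _ hf')).1 huf

/-! ### Matrix differential operators -/

/-- The action `D.apply Q`, as a bilinear map in `D` and `Q`. -/
def MatDiffOp.applyₗ :
    MatDiffOp M r →ₗ[ℝ] (Fin q → 𝒜 M r) →ₗ[ℝ] (Fin q → 𝒜 M r) :=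
  LinearMap.mk₂ ℝ (fun D Q α => ∑ β, diffOp (D α β) (Q β))
    (fun D E Q => funext fun α => by simp [Finset.sum_add_distrib])
    (fun c D Q => funext fun α => by simp [Finset.smul_sum])
    (fun D P Q => funext fun α => by simp [Finset.sum_add_distrib])
    (fun c D Q => funext fun α => by simp [Finset.smul_sum])

theorem MatDiffOp.applyₗ_apply (D : MatDiffOp M r) (Q : Fin q → 𝒜 M r) (α : Fin q) :
    applyₗ D Q α = ∑ β, diffOp (D α β) (Q β) := rfl

theorem MatDiffOp.apply_eq_applyₗ (D : MatDiffOp M r) (Q : Fin q → 𝒜 M r) :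
    D.apply Q = applyₗ D Q := by
  ext1 α
  simp only [MatDiffOp.apply, applyₗ_apply, diffOp_apply, iterOp_totalDeriv]

theorem bracket_eq_dotProduct (D : MatDiffOp M r) (P L : 𝒜 M r) :
    bracket D P L = euler P ⬝ᵥ MatDiffOp.applyₗ D (euler L) := by
  rw [← MatDiffOp.apply_eq_applyₗ]
  rfl

/-- The operator `D` is skew-adjoint modulo the ideal `I`. -/
def IsSkewAdjointMod (I : Ideal (𝒜 M r)) (D : MatDiffOp M r) : Prop :=
  ∀ P Q : Fin q → 𝒜 M r, integral I (P ⬝ᵥ MatDiffOp.applyₗ D Q) =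
    -integral I (Q ⬝ᵥ MatDiffOp.applyₗ D P)

/-- The bracket of `D` is skew-symmetric and satisfies the Jacobi identity modulo the ideal `I`. -/
def IsHamiltonianMod (I : Ideal (𝒜 M r)) (D : MatDiffOp M r) : Prop :=
  (∀ P L : 𝒜 M r, integral I (bracket D P L + bracket D L P) = 0) ∧
  ∀ P L R : 𝒜 M r, integral I (bracket D (bracket D P L) R + bracket D (bracket D L R) P +
    bracket D (bracket D R P) L) = 0

theorem isHamiltonian_iff {D : MatDiffOp M r} : IsHamiltonian D ↔ IsHamiltonianMod ⊥ D := by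
  simp only [IsHamiltonian, IsHamiltonianMod, integralZero_iff]

theorem isApproxHamiltonian_iff {N : ℕ} {D : MatDiffOp M r} :
    IsApproxHamiltonian N D ↔ IsHamiltonianMod (smallIdeal M r N) D := by
  simp only [IsApproxHamiltonian, IsHamiltonianMod, integralSmall_iff]

theorem isSkewAdjoint_iff {D : MatDiffOp M r} : IsSkewAdjoint D ↔ IsSkewAdjointMod ⊥ D := by
  refine forall₂_congr fun P Q => ?_
  have hneg : Q ⬝ᵥ MatDiffOp.apply (-D) P = -(Q ⬝ᵥ MatDiffOp.applyₗ D P) := by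
    rw [MatDiffOp.apply_eq_applyₗ, ← neg_one_smul ℝ D, map_smul, LinearMap.smul_apply,
      dotProduct_smul, neg_one_smul]
  rw [integralZero_iff, map_sub, sub_eq_zero, ← map_neg, ← hneg, MatDiffOp.apply_eq_applyₗ]
  rfl

theorem IsHamiltonianMod.mono {I J : Ideal (𝒜 M r)} (hIJ : I ≤ J) {D : MatDiffOp M r}
    (hD : IsHamiltonianMod I D) : IsHamiltonianMod J D :=
  ⟨fun P L => integral_eq_zero_mono hIJ (hD.1 P L),
    fun P L R => integral_eq_zero_mono hIJ (hD.2 P L R)⟩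

/-- The symbol of `(D + D*)_{αβ}`. -/
def MatDiffOp.symmSymbol (D : MatDiffOp M r) (α β : Fin q) : Symbol M r :=
  D α β + formalAdjoint (D β α)

theorem MatDiffOp.integral_dotProduct_applyₗ_add (I : Ideal (𝒜 M r)) (D : MatDiffOp M r)
    (P Q : Fin q → 𝒜 M r) :
    integral I (P ⬝ᵥ applyₗ D Q) + integral I (Q ⬝ᵥ applyₗ D P) =
      ∑ α, ∑ β, integral I (P α * diffOp (D.symmSymbol α β) (Q β)) := by
  simp only [symmSymbol, map_add, LinearMap.add_apply, mul_add, Finset.sum_add_distrib,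
    diffOp_formalAdjoint, dotProduct, applyₗ_apply, Finset.mul_sum, map_sum, integral_mul_diffOp]
  congr 1
  exact Finset.sum_comm

theorem IsJetIdeal.symmSymbol_mem {I : Ideal (𝒜 M r)} (hI : IsJetIdeal I) {D : MatDiffOp M r}
    (hD : ∀ P L : 𝒜 M r, integral I (bracket D P L + bracket D L P) = 0) (α β : Fin q)
    (J : MultiIndex p) : D.symmSymbol α β J ∈ I := by
  refine coeff_mem_of_diffOp_mem (fun φ hφ => hI.mem_of_integral_mul (α := α) fun L ψ hL => ?_) J
  have h := hD L (φ * coordFun (.u β 0))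
  rw [map_add, bracket_eq_dotProduct, bracket_eq_dotProduct,
    MatDiffOp.integral_dotProduct_applyₗ_add, hL, hφ.euler_mul_u,
    Finset.sum_eq_single_of_mem α (Finset.mem_univ α) fun γ _ hγ => by simp [hγ],
    Finset.sum_eq_single_of_mem β (Finset.mem_univ β) fun γ _ hγ => by simp [hγ]] at h
  rwa [Pi.single_eq_same, Pi.single_eq_same] at h

theorem IsHamiltonianMod.isSkewAdjointMod {I : Ideal (𝒜 M r)} (hI : IsJetIdeal I)
    {D : MatDiffOp M r} (hD : IsHamiltonianMod I D) : IsSkewAdjointMod I D := by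
  intro P Q
  rw [eq_neg_iff_add_eq_zero, MatDiffOp.integral_dotProduct_applyₗ_add]
  refine Finset.sum_eq_zero fun α _ => Finset.sum_eq_zero fun β _ => integral_of_mem ?_
  rw [diffOp_apply]
  exact I.mul_mem_left _ (I.sum_mem fun J _ =>
    I.mul_mem_right _ (hI.symmSymbol_mem hD.1 α β J))

theorem IsSkewAdjointMod.smul_add_smul {I : Ideal (𝒜 M r)} {D E : MatDiffOp M r}
    (hD : IsSkewAdjointMod I D) (hE : IsSkewAdjointMod I E) (a b : ℝ) :
    IsSkewAdjointMod I (a • D + b • E) := by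
  intro P Q
  simp only [map_add, map_smul, LinearMap.add_apply, LinearMap.smul_apply, dotProduct_add,
    dotProduct_smul, hD P Q, hE P Q]
  module

/-! ### Multi-vectors -/

section MultiVec

variable {k : ℕ}

/-- The total derivative of multi-vectors, as a linear map. -/
def MultiVec.totalDₗ (i : Fin p) : Module.End ℝ (MultiVec M r k) :=
  Finsupp.lsum ℝ fun a => Finsupp.lsingle a ∘ₗ (totalD i).toLinearMap +
    ∑ s, Finsupp.lsingle (Function.update a s ((a s).incr i))

theorem MultiVec.totalDₗ_single (i : Fin p) (a : Fin k → Lab p q) (f : 𝒜 M r) :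
    totalDₗ i (Finsupp.single a f) = Finsupp.single a (totalD i f) +
      ∑ s, Finsupp.single (Function.update a s ((a s).incr i)) f := by
  simp [totalDₗ]

theorem MultiVec.totalDeriv_eq_totalDₗ :
    (totalDeriv : Fin p → MultiVec M r k → MultiVec M r k) = fun i η => totalDₗ i η := by
  funext i η
  rw [totalDeriv, totalDeriv_eq_totalD, totalDₗ, Finsupp.lsum_apply]
  exact Finsupp.sum_congr fun a _ => by simp

/-- The total divergence of multi-vectors. -/
def MultiVec.totalDivergence : (Fin p → MultiVec M r k) →ₗ[ℝ] MultiVec M r k :=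
  ∑ i, totalDₗ i ∘ₗ LinearMap.proj i

theorem MultiVec.totalDivergence_apply (X : Fin p → MultiVec M r k) :
    totalDivergence X = ∑ i, totalDₗ i (X i) := by
  simp [totalDivergence]

theorem MultiVec.totalDivergence_single (i : Fin p) (η : MultiVec M r k) :
    totalDivergence (Pi.single i η) = totalDₗ i η := by
  rw [totalDivergence_apply,
    Finset.sum_eq_single_of_mem i (Finset.mem_univ i) fun j _ hj => by simp [hj],
    Pi.single_eq_same]

/-- The evaluation of a formal sum of monomials on the characteristics `P 0, …, P (k - 1)`, where
the `s`-th factor `θ^α_J` of a monomial becomes `D_J (P s α)`. The value of the `k`-vector that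
`η` represents is obtained after antisymmetrization. -/
def MultiVec.pairing (P : Fin k → Fin q → 𝒜 M r) : MultiVec M r k →ₗ[𝒜 M r] 𝒜 M r :=
  Finsupp.linearCombination (𝒜 M r) fun a => ∏ s, totalDJ (a s).2 (P s (a s).1)

theorem MultiVec.pairing_single (P : Fin k → Fin q → 𝒜 M r) (a : Fin k → Lab p q) (f : 𝒜 M r) :
    pairing P (Finsupp.single a f) = f * ∏ s, totalDJ (a s).2 (P s (a s).1) := by
  simp [pairing]

theorem MultiVec.pairing_mem {I : Ideal (𝒜 M r)} (P : Fin k → Fin q → 𝒜 M r) {η : MultiVec M r k}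
    (hη : ∀ a, η a ∈ I) : pairing P η ∈ I :=
  I.sum_mem fun a _ => I.mul_mem_right _ (hη a)

theorem totalD_prod (i : Fin p) (g : Fin k → Lab p q → 𝒜 M r)
    (hg : ∀ s c, totalD i (g s c) = g s (c.incr i)) (a : Fin k → Lab p q) :
    totalD i (∏ t, g t (a t)) = ∑ s, ∏ t, g t (Function.update a s ((a s).incr i) t) := by
  induction k with
  | zero => simp
  | succ k ih =>
    rw [Fin.prod_univ_succ, Derivation.leibniz, ih (fun t => g t.succ) (fun s c => hg _ c)
      (fun t => a t.succ), hg, Fin.sum_univ_succ, smul_eq_mul, smul_eq_mul, add_comm,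
      Finset.mul_sum]
    congr 1
    · rw [Fin.prod_univ_succ, mul_comm]
      simp
    · refine Finset.sum_congr rfl fun s _ => ?_
      rw [Fin.prod_univ_succ]
      simp [Function.update_apply, (Fin.succ_ne_zero s).symm]

theorem MultiVec.pairing_totalDₗ (i : Fin p) (P : Fin k → Fin q → 𝒜 M r) (η : MultiVec M r k) :
    pairing P (totalDₗ i η) = totalD i (pairing P η) := by
  induction η using Finsupp.induction_linear with
  | zero => simp
  | add η ξ hη hξ => simp only [map_add, hη, hξ]
  | single a f =>
    simp only [totalDₗ_single, map_add, map_sum, pairing_single, Derivation.leibniz, smul_eq_mul]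
    rw [totalD_prod i (fun s (c : Lab p q) => totalDJ c.2 (P s c.1)) fun s c =>
      (totalDJ_add_single c.2 i _).symm, Finset.mul_sum, add_comm, mul_comm (totalD i f)]

theorem MultiVec.integral_pairing_totalDivergence (I : Ideal (𝒜 M r)) (P : Fin k → Fin q → 𝒜 M r)
    (X : Fin p → MultiVec M r k) : integral I (pairing P (totalDivergence X)) = 0 := by
  simp [totalDivergence_apply, pairing_totalDₗ, integral_totalD]

/-- The antisymmetrization `η ↦ ∑_σ sgn σ · (η ∘ σ)`, without the factor `1 / k!`. -/
def MultiVec.alternation : MultiVec M r k →ₗ[ℝ] MultiVec M r k :=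
  ∑ σ : Equiv.Perm (Fin k), (Equiv.Perm.sign σ : ℤ) •
    (Finsupp.domLCongr (σ.arrowCongr (Equiv.refl (Lab p q)))).toLinearMap

theorem MultiVec.alternation_apply (η : MultiVec M r k) (a : Fin k → Lab p q) :
    alternation η a = altCoeff η a := by
  simp only [alternation, LinearMap.sum_apply, Finsupp.finsetSum_apply]
  rfl

theorem MultiVec.alternation_single (a : Fin k → Lab p q) (f : 𝒜 M r) :
    alternation (Finsupp.single a f) = ∑ σ : Equiv.Perm (Fin k),
      (Equiv.Perm.sign σ : ℤ) • Finsupp.single (a ∘ σ.symm) f := by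
  simp only [alternation, LinearMap.sum_apply, LinearMap.smul_apply, LinearEquiv.coe_coe,
    Finsupp.domLCongr_single]
  rfl

theorem MultiVec.pairing_alternation (P : Fin k → Fin q → 𝒜 M r) (η : MultiVec M r k) :
    pairing P (alternation η) =
      ∑ σ : Equiv.Perm (Fin k), (Equiv.Perm.sign σ : ℤ) • pairing (P ∘ σ) η := by
  induction η using Finsupp.induction_linear with
  | zero => simp
  | add η ξ hη hξ => simp only [map_add, hη, hξ, smul_add, Finset.sum_add_distrib]
  | single a f =>
    rw [alternation_single, map_sum]
    refine Finset.sum_congr rfl fun σ _ => ?_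
    rw [map_zsmul, pairing_single, pairing_single, ← Equiv.prod_comp σ]
    simp

theorem MultiVec.alternation_totalDₗ (i : Fin p) (η : MultiVec M r k) :
    alternation (totalDₗ i η) = totalDₗ i (alternation η) := by
  induction η using Finsupp.induction_linear with
  | zero => simp
  | add η ξ hη hξ => simp only [map_add, hη, hξ]
  | single a f =>
    simp only [totalDₗ_single, map_add, map_sum, alternation_single, map_zsmul, smul_add,
      Finset.sum_add_distrib, Finset.smul_sum]
    congr 1
    rw [Finset.sum_comm]
    refine Finset.sum_congr rfl fun σ _ => ?_
    rw [← Equiv.sum_comp σ fun s => (Equiv.Perm.sign σ : ℤ) • Finsupp.single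
      (Function.update (a ∘ σ.symm) s (((a ∘ σ.symm) s).incr i)) f]
    simp [Function.update_comp_equiv]

theorem MultiVec.alternation_totalDivergence (X : Fin p → MultiVec M r k) :
    alternation (totalDivergence X) = totalDivergence fun i => alternation (X i) := by
  simp only [totalDivergence_apply, map_sum, alternation_totalDₗ]

theorem altCoeff_comp (η : MultiVec M r k) (a : Fin k → Lab p q) (τ : Equiv.Perm (Fin k)) :
    altCoeff η (a ∘ τ) = (Equiv.Perm.sign τ : ℤ) • altCoeff η a := by
  rw [altCoeff, altCoeff, Finset.smul_sum, ← Equiv.sum_comp (Equiv.mulLeft τ)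
    fun σ : Equiv.Perm (Fin k) =>
      (Equiv.Perm.sign τ : ℤ) • (Equiv.Perm.sign σ : ℤ) • η (a ∘ σ)]
  refine Finset.sum_congr rfl fun σ _ => ?_
  rw [smul_smul, Equiv.coe_mulLeft, Equiv.Perm.sign_mul, Units.val_mul, ← mul_assoc,
    Int.units_coe_mul_self, one_mul, Equiv.Perm.coe_mul, Function.comp_assoc]

theorem MultiVec.alternation_alternation (η : MultiVec M r k) :
    alternation (alternation η) = (k.factorial : ℝ) • alternation η := by
  refine Finsupp.ext fun a => ?_
  rw [alternation_apply, altCoeff, Finsupp.smul_apply, alternation_apply]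
  simp only [alternation_apply, altCoeff_comp, smul_smul, Int.units_coe_mul_self, one_smul,
    Finset.sum_const, Finset.card_univ, Fintype.card_perm, Fintype.card_fin, Nat.cast_smul_eq_nsmul]

end MultiVec

/-! ### The normal form of a functional multi-vector -/

section NormalForm

variable {k : ℕ} {I : Ideal (𝒜 M r)}

/-- A formal sum of `(k + 1)`-fold monomials, seen as a family of formal sums of `k`-fold monomials
indexed by the label of the first factor. -/
def MultiVec.headCurry : MultiVec M r (k + 1) ≃ₗ[𝒜 M r] (Lab p q →₀ MultiVec M r k) :=
  Finsupp.domLCongr (Fin.consEquiv fun _ => Lab p q).symm ≪≫ₗ Finsupp.curryLinearEquiv (𝒜 M r)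

theorem MultiVec.headCurry_single_cons (c : Lab p q) (a : Fin k → Lab p q) (f : 𝒜 M r) :
    headCurry (Finsupp.single (Fin.cons c a) f) = Finsupp.single c (Finsupp.single a f) := by
  simp [headCurry, Fin.consEquiv]

theorem MultiVec.headCurry_apply (η : MultiVec M r (k + 1)) (c : Lab p q) (a : Fin k → Lab p q) :
    headCurry η c a = η (Fin.cons c a) := by
  rfl

theorem MultiVec.pairing_cons (P : Fin q → 𝒜 M r) (G : Fin k → Fin q → 𝒜 M r)
    (η : MultiVec M r (k + 1)) :
    pairing (Fin.cons P G : Fin (k + 1) → Fin q → 𝒜 M r) η =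
      ∑ α, diffOp (jetComponent α (Finsupp.mapRange.linearMap (pairing G) (headCurry η)))
        (P α) := by
  rw [← linearCombination_totalDJ]
  induction η using Finsupp.induction_linear with
  | zero => simp
  | add η ξ hη hξ => simp only [map_add, hη, hξ]
  | single b f =>
    obtain ⟨c, a, rfl⟩ : ∃ c a, b = Fin.cons c a := ⟨b 0, Fin.tail b, (Fin.cons_self_tail b).symm⟩
    rw [headCurry_single_cons, Finsupp.mapRange.linearMap_apply, Finsupp.mapRange_single,
      Finsupp.linearCombination_single, pairing_single, pairing_single, Fin.prod_univ_succ]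
    simp only [Fin.cons_zero, Fin.cons_succ, smul_eq_mul]
    ring

/-- The wedge product `θ_c ∧ η`. -/
def MultiVec.thetaWedge (c : Lab p q) : MultiVec M r k →ₗ[𝒜 M r] MultiVec M r (k + 1) :=
  headCurry.symm.toLinearMap ∘ₗ Finsupp.lsingle c

theorem MultiVec.thetaWedge_single (c : Lab p q) (a : Fin k → Lab p q) (f : 𝒜 M r) :
    thetaWedge c (Finsupp.single a f) = Finsupp.single (Fin.cons c a) f :=
  headCurry.symm_apply_eq.2 (headCurry_single_cons c a f).symm

theorem MultiVec.pairing_thetaWedge (P : Fin q → 𝒜 M r) (G : Fin k → Fin q → 𝒜 M r) (c : Lab p q)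
    (η : MultiVec M r k) :
    pairing (Fin.cons P G : Fin (k + 1) → Fin q → 𝒜 M r) (thetaWedge c η) =
      totalDJ c.2 (P c.1) * pairing G η := by
  rw [pairing_cons, ← linearCombination_totalDJ]
  simp [thetaWedge, mul_comm]

theorem MultiVec.totalDₗ_thetaWedge (i : Fin p) (c : Lab p q) (η : MultiVec M r k) :
    totalDₗ i (thetaWedge c η) = thetaWedge (c.incr i) η + thetaWedge c (totalDₗ i η) := by
  induction η using Finsupp.induction_linear with
  | zero => simp
  | add η ξ hη hξ => simp only [map_add, hη, hξ]; abel
  | single a f =>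
    simp only [thetaWedge_single, totalDₗ_single, map_add, map_sum, Fin.sum_univ_succ,
      Fin.cons_zero, Fin.cons_succ, Fin.update_cons_zero, Fin.cons_update]
    abel

theorem MultiVec.thetaWedge_mem (c : Lab p q) {η : MultiVec M r k} (hη : ∀ a, η a ∈ I)
    (b : Fin (k + 1) → Lab p q) : thetaWedge c η b ∈ I := by
  rw [← Fin.cons_self_tail b, ← headCurry_apply]
  simp only [thetaWedge, LinearMap.comp_apply, LinearEquiv.coe_coe, LinearEquiv.apply_symm_apply,
    Finsupp.lsingle_apply, Finsupp.single_apply]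
  split_ifs
  · exact hη _
  · exact I.zero_mem

theorem MultiVec.exists_thetaWedge_eq (α : Fin q) (J : MultiIndex p) (η : MultiVec M r k) :
    ∃ ξ X, thetaWedge (α, J) η = thetaWedge (α, 0) ξ + totalDivergence X := by
  induction J using MultiIndex.induction generalizing η with
  | zero => exact ⟨η, 0, by rw [map_zero, add_zero]⟩
  | add_single i J ih =>
    obtain ⟨ξ, X, hξ⟩ := ih (totalDₗ i η)
    refine ⟨-ξ, Pi.single i (thetaWedge (α, J) η) - X, ?_⟩
    rw [map_sub, totalDivergence_single, totalDₗ_thetaWedge, hξ, map_neg, Lab.incr]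
    abel

theorem MultiVec.exists_normal_form (η : MultiVec M r (k + 1)) :
    ∃ (C : Fin q → MultiVec M r k) (X : Fin p → MultiVec M r (k + 1)),
      η = ∑ α, thetaWedge (α, 0) (C α) + totalDivergence X := by
  induction η using Finsupp.induction_linear with
  | zero => exact ⟨0, 0, by simp⟩
  | add η ξ hη hξ =>
    obtain ⟨C, X, rfl⟩ := hη
    obtain ⟨C', X', rfl⟩ := hξ
    refine ⟨C + C', X + X', ?_⟩
    simp only [Pi.add_apply, map_add, Finset.sum_add_distrib]
    abel
  | single a f =>
    obtain ⟨ξ, X, hξ⟩ := exists_thetaWedge_eq (a 0).1 (a 0).2 (Finsupp.single (Fin.tail a) f)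
    refine ⟨Pi.single (a 0).1 ξ, X, ?_⟩
    rw [Finset.sum_eq_single_of_mem _ (Finset.mem_univ (a 0).1) fun β _ hβ => by simp [hβ],
      Pi.single_eq_same, ← hξ, thetaWedge_single, Prod.mk.eta, Fin.cons_self_tail]

theorem MultiVec.coeff_mem_of_pairing_mem {η : MultiVec M r k}
    (hη : ∀ (β : Fin k → Fin q) (φ : Fin k → 𝒜 M r), (∀ s, IsBaseFunction (φ s)) →
      pairing (fun s => Pi.single (β s) (φ s)) η ∈ I) (a : Fin k → Lab p q) : η a ∈ I := by
  induction k with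
  | zero =>
    have hsingle : η = Finsupp.single a (η a) :=
      Finsupp.ext fun b => by rw [Subsingleton.elim b a, Finsupp.single_eq_same]
    have hpair := hη Fin.elim0 Fin.elim0 fun s => s.elim0
    rw [hsingle, pairing_single] at hpair
    simpa using hpair
  | succ k ih =>
    rw [← Fin.cons_self_tail a, ← headCurry_apply]
    refine ih (fun β φ hφ => ?_) _
    set G : Fin k → Fin q → 𝒜 M r := fun s => Pi.single (β s) (φ s)
    refine coeff_mem_of_diffOp_mem (a := jetComponent (a 0).1
      (Finsupp.mapRange.linearMap (pairing G) (headCurry η))) (fun ψ hψ => ?_) (a 0).2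
    have hpair := hη (Fin.cons (a 0).1 β) (Fin.cons ψ φ) (Fin.cases hψ hφ)
    have hcons : (fun s => Pi.single ((Fin.cons (a 0).1 β : Fin (k + 1) → Fin q) s)
        ((Fin.cons ψ φ : Fin (k + 1) → 𝒜 M r) s)) =
        (Fin.cons (Pi.single (a 0).1 ψ) G : Fin (k + 1) → Fin q → 𝒜 M r) :=
      funext (Fin.cases rfl fun _ => rfl)
    rw [hcons, pairing_cons,
      Finset.sum_eq_single_of_mem _ (Finset.mem_univ (a 0).1) fun γ _ hγ => by simp [hγ],
      Pi.single_eq_same] at hpair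
    exact hpair

/-- The functional multi-vector `∫ η dx` vanishes modulo the ideal `I`: modulo total divergences,
its antisymmetrized coefficients belong to `I`. -/
def MultiVec.IsNullMod (I : Ideal (𝒜 M r)) (η : MultiVec M r k) : Prop :=
  ∃ X : Fin p → MultiVec M r k, ∀ a,
    altCoeff (η - ∑ i, MultiVec.totalDeriv i (X i)) a ∈ I

theorem MultiVec.isNullMod_iff {η : MultiVec M r k} :
    η.IsNullMod I ↔ ∃ X, ∀ a, alternation (η - totalDivergence X) a ∈ I := by
  simp only [IsNullMod, alternation_apply, totalDivergence_apply, totalDeriv_eq_totalDₗ]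

theorem MultiVec.IsNullMod.integral_pairing_alternation {η : MultiVec M r k} (hη : η.IsNullMod I)
    (P : Fin k → Fin q → 𝒜 M r) : integral I (pairing P (alternation η)) = 0 := by
  obtain ⟨X, hX⟩ := isNullMod_iff.1 hη
  have hmem := integral_of_mem (pairing_mem P hX)
  rwa [map_sub, map_sub, map_sub, alternation_totalDivergence,
    integral_pairing_totalDivergence, sub_zero] at hmem

theorem MultiVec.isNullMod_of_alternation_eq {η ξ : MultiVec M r k}
    {X : Fin p → MultiVec M r k} (hξ : ∀ a, ξ a ∈ I)
    (hη : alternation η = ξ + totalDivergence X) : η.IsNullMod I := by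
  refine isNullMod_iff.2 ⟨(k.factorial : ℝ)⁻¹ • X, fun a => ?_⟩
  have halt : alternation (η - totalDivergence ((k.factorial : ℝ)⁻¹ • X)) =
      (k.factorial : ℝ)⁻¹ • alternation ξ := by
    have hsmul : (k.factorial : ℝ)⁻¹ • alternation (alternation η) = alternation η := by
      rw [alternation_alternation, inv_smul_smul₀ (Nat.cast_ne_zero.2 k.factorial_ne_zero)]
    have hsub : ξ = alternation η - totalDivergence X := by rw [hη, add_sub_cancel_right]
    rw [hsub, map_sub, map_sub, smul_sub, hsmul, map_smul, map_smul]
  rw [halt, Finsupp.smul_apply, alternation_apply]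
  exact I.smul_of_tower_mem _ (I.sum_mem fun σ _ => zsmul_mem (hξ _) _)

theorem IsJetIdeal.normalForm_coeff_mem (hI : IsJetIdeal I) {C : Fin q → MultiVec M r k}
    (hC : ∀ L : Fin (k + 1) → 𝒜 M r, integral I (MultiVec.pairing (fun s => euler (L s))
      (∑ α, MultiVec.thetaWedge (α, 0) (C α))) = 0) (α : Fin q) (a : Fin k → Lab p q) :
    C α a ∈ I := by
  refine MultiVec.coeff_mem_of_pairing_mem (fun β φ hφ => ?_) a
  refine hI.mem_of_integral_mul (α := α) fun L ψ hL => ?_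
  have hcons : (fun s => euler ((Fin.cons L fun s => φ s * coordFun (.u (β s) 0) :
      Fin (k + 1) → 𝒜 M r) s)) =
      (Fin.cons (Pi.single α ψ) fun s => Pi.single (β s) (φ s) : Fin (k + 1) → Fin q → 𝒜 M r) :=
    funext (Fin.cases hL fun s => (hφ s).euler_mul_u (β s))
  have h := hC (Fin.cons L fun s => φ s * coordFun (.u (β s) 0))
  simp only [hcons, map_sum, MultiVec.pairing_thetaWedge, totalDJ_zero] at h
  rwa [Finset.sum_eq_single_of_mem _ (Finset.mem_univ α) fun γ _ hγ => by simp [hγ],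
    Pi.single_eq_same] at h

theorem IsJetIdeal.isNullMod_iff_integral_pairing (hI : IsJetIdeal I) {η : MultiVec M r (k + 1)} :
    η.IsNullMod I ↔ ∀ L : Fin (k + 1) → 𝒜 M r,
      integral I (MultiVec.pairing (fun s => euler (L s)) (MultiVec.alternation η)) = 0 := by
  refine ⟨fun hη L => hη.integral_pairing_alternation _, fun hη => ?_⟩
  obtain ⟨C, X, hCX⟩ := MultiVec.exists_normal_form (MultiVec.alternation η)
  refine MultiVec.isNullMod_of_alternation_eq (fun a => ?_) hCX
  rw [Finsupp.finsetSum_apply]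
  refine I.sum_mem fun α _ => MultiVec.thetaWedge_mem _ (hI.normalForm_coeff_mem (fun L => ?_) α) a
  have h := hη L
  rwa [hCX, map_add, map_add, MultiVec.integral_pairing_totalDivergence, add_zero] at h

end NormalForm

/-! ### Derivatives of operators along evolutionary vector fields -/

section DerivAlong

variable {k : ℕ} {I : Ideal (𝒜 M r)}

theorem prEv_add (V W : Fin q → 𝒜 M r) (f : 𝒜 M r) : prEv (V + W) f = prEv V f + prEv W f := by
  simp only [prEv_apply, Pi.add_apply, map_add, Finset.sum_add_distrib]

theorem prEv_smul (t : ℝ) (V : Fin q → 𝒜 M r) (f : 𝒜 M r) : prEv (t • V) f = t • prEv V f := by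
  simp only [prEv_apply, Pi.smul_apply, map_smul, Finset.smul_sum]

/-- The Fréchet derivative `E'[V]` of a matrix differential operator `E` in the direction `V`: the
derivation `pr v_V` is applied to all its coefficients. -/
def MatDiffOp.derivAlong : (Fin q → 𝒜 M r) →ₗ[ℝ] MatDiffOp M r →ₗ[ℝ] MatDiffOp M r :=
  LinearMap.mk₂ ℝ (fun V E => E.map (Finsupp.mapRange.linearMap (prEv V).toLinearMap))
    (fun V W E => by ext1 α β; refine Finsupp.ext fun J => ?_; simp [prEv_add])
    (fun t V E => by ext1 α β; refine Finsupp.ext fun J => ?_; simp [prEv_smul])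
    (fun V E E' => by ext1 α β; exact map_add (Finsupp.mapRange.linearMap (prEv V).toLinearMap) _ _)
    (fun t V E => by ext1 α β; simp)

theorem MatDiffOp.derivAlong_apply (V : Fin q → 𝒜 M r) (E : MatDiffOp M r) (α β : Fin q) :
    derivAlong V E α β = Finsupp.mapRange.linearMap (prEv V).toLinearMap (E α β) := rfl

theorem prEv_diffOp (V : Fin q → 𝒜 M r) (a : Symbol M r) (f : 𝒜 M r) :
    prEv V (diffOp a f) =
      diffOp (Finsupp.mapRange.linearMap (prEv V).toLinearMap a) f + diffOp a (prEv V f) := by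
  induction a using Finsupp.induction_linear with
  | zero => simp
  | add a b ha hb => simp only [map_add, LinearMap.add_apply, ha, hb]; abel
  | single J c =>
    rw [Finsupp.mapRange.linearMap_apply, Finsupp.mapRange_single, diffOp_single, diffOp_single,
      diffOp_single, Derivation.leibniz, prEv_totalDJ, smul_eq_mul, smul_eq_mul, add_comm,
      mul_comm (totalDJ J f)]
    rfl

theorem MatDiffOp.prEv_comp_applyₗ (V : Fin q → 𝒜 M r) (E : MatDiffOp M r) (Q : Fin q → 𝒜 M r) :
    prEv V ∘ applyₗ E Q = applyₗ (derivAlong V E) Q + applyₗ E (prEv V ∘ Q) := by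
  ext1 α
  simp only [Function.comp_apply, Pi.add_apply, applyₗ_apply, map_sum, prEv_diffOp,
    Finset.sum_add_distrib, derivAlong_apply]

theorem prEv_dotProduct_applyₗ (V : Fin q → 𝒜 M r) (E : MatDiffOp M r) (P Q : Fin q → 𝒜 M r) :
    prEv V (P ⬝ᵥ MatDiffOp.applyₗ E Q) = (prEv V ∘ P) ⬝ᵥ MatDiffOp.applyₗ E Q +
      P ⬝ᵥ MatDiffOp.applyₗ (MatDiffOp.derivAlong V E) Q +
        P ⬝ᵥ MatDiffOp.applyₗ E (prEv V ∘ Q) := by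
  rw [derivation_dotProduct, MatDiffOp.prEv_comp_applyₗ, dotProduct_add, add_assoc]

theorem IsSkewAdjointMod.derivAlong (hI : IsJetIdeal I) {E : MatDiffOp M r}
    (hE : IsSkewAdjointMod I E) (V : Fin q → 𝒜 M r) :
    IsSkewAdjointMod I (MatDiffOp.derivAlong V E) := by
  intro P Q
  have h := hI.integral_prEv V (f := P ⬝ᵥ MatDiffOp.applyₗ E Q + Q ⬝ᵥ MatDiffOp.applyₗ E P)
    (by rw [map_add, hE P Q, neg_add_cancel])
  simp only [map_add, prEv_dotProduct_applyₗ] at h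
  have hP := hE (prEv V ∘ P) Q
  have hQ := hE (prEv V ∘ Q) P
  linear_combination (norm := module) h - hP - hQ

end DerivAlong

/-! ### Evaluation of the prolonged bi-vector -/

section Prolong

variable {k : ℕ} {I : Ideal (𝒜 M r)}

theorem MultiVec.pairing_eq_sum (G : Fin k → Fin q → 𝒜 M r) (η : MultiVec M r k) :
    pairing G η = η.sum fun a f => f * ∏ s, totalDJ (a s).2 (G s (a s).1) := rfl

theorem MultiVec.pairing_wedge (P : Fin q → 𝒜 M r) (G : Fin k → Fin q → 𝒜 M r) (v : MultiVec M r 1)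
    (η : MultiVec M r k) : pairing (Fin.cons P G : Fin (k + 1) → Fin q → 𝒜 M r) (v.wedge η) =
      pairing (fun _ => P) v * pairing G η := by
  rw [wedge, map_finsuppSum, pairing_eq_sum _ v, Finsupp.sum_mul]
  refine Finsupp.sum_congr fun b _ => ?_
  rw [map_finsuppSum, pairing_eq_sum, Finsupp.mul_sum]
  refine Finsupp.sum_congr fun a _ => ?_
  rw [pairing_single, Fin.prod_univ_succ, mul_mul_mul_comm, Fin.prod_univ_one]
  simp only [Fin.cons_zero, Fin.cons_succ]

theorem MultiVec.pairing_opTheta (P : Fin q → 𝒜 M r) (D : MatDiffOp M r) (α : Fin q) :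
    pairing (fun _ => P) (opTheta D α) = MatDiffOp.applyₗ D P α := by
  simp only [opTheta, map_sum, map_finsuppSum, pairing_single, MatDiffOp.applyₗ_apply, diffOp_apply,
    Finset.univ_unique, Finset.prod_singleton]

theorem MultiVec.pairing_iterOp (G : Fin k → Fin q → 𝒜 M r) (J : MultiIndex p)
    (η : MultiVec M r k) : pairing G (iterOp totalDeriv J η) = totalDJ J (pairing G η) := by
  rw [totalDeriv_eq_totalDₗ, totalDJ_eq_iterOp]
  exact iterOp_semiconj (fun i v => pairing_totalDₗ i G v) J η

theorem MultiVec.pairing_prolong (D : MatDiffOp M r) (P : Fin q → 𝒜 M r)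
    (G : Fin k → Fin q → 𝒜 M r) (η : MultiVec M r k) :
    pairing (Fin.cons P G : Fin (k + 1) → Fin q → 𝒜 M r) (prolong D η) =
      pairing G (Finsupp.mapRange.linearMap (prEv (MatDiffOp.applyₗ D P)).toLinearMap η) := by
  rw [prolong, map_finsuppSum, pairing_eq_sum, Finsupp.mapRange.linearMap_apply,
    Finsupp.sum_mapRange_index fun a => zero_mul _]
  refine Finsupp.sum_congr fun a _ => ?_
  have hsupp : {c : Lab p q | pderiv c.u (η a) ≠ 0}.Finite := (jetGradient (η a)).hasFiniteSupport
  have hprEv : prEv (MatDiffOp.applyₗ D P) (η a) =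
      ∑ᶠ c : Lab p q, totalDJ c.2 (MatDiffOp.applyₗ D P c.1) * pderiv c.u (η a) :=
    (vectorField_verticalCoeff _ _).trans (finsum_mul_pderiv _ _).symm
  rw [Derivation.coeFn_coe, hprEv, finsum_mul' _ _ (hsupp.subset fun c hc h => hc (by simp [h])),
    map_finsum _ (hsupp.subset fun c hc h => hc (by simp [wedge, h]))]
  exact finsum_congr fun c => by
    rw [pairing_wedge, pairing_iterOp, pairing_opTheta, pairing_single, mul_assoc]

theorem MultiVec.wedge_single_one (c : Lab p q) (η : MultiVec M r k) :
    wedge (Finsupp.single (fun _ => c) 1) η = Finsupp.mapDomain (Fin.cons c) η := by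
  rw [wedge, Finsupp.sum_single_index (by simp)]
  simp only [one_mul]
  rfl

theorem opTheta_eq_mapDomain (D : MatDiffOp M r) (α : Fin q) :
    opTheta D α = ∑ β, Finsupp.mapDomain (fun J _ => (β, J)) (D α β) := rfl

theorem bivector_eq_mapDomain (E : MatDiffOp M r) :
    bivector E = (1 / 2 : ℝ) • ∑ α, ∑ β, Finsupp.mapDomain (Fin.cons (α, 0))
      (Finsupp.mapDomain (fun J _ => (β, J)) (E α β)) := by
  simp only [bivector, MultiVec.wedge_single_one, opTheta_eq_mapDomain,
    Finsupp.mapDomain_finsetSum]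

theorem MultiVec.pairing_bivector (E : MatDiffOp M r) (Q R : Fin q → 𝒜 M r) :
    pairing ![Q, R] (bivector E) = (1 / 2 : ℝ) • (Q ⬝ᵥ MatDiffOp.applyₗ E R) := by
  have hcons : ![Q, R] = (Fin.cons Q fun _ => R : Fin 2 → Fin q → 𝒜 M r) :=
    funext <| Fin.forall_fin_two.2 ⟨rfl, rfl⟩
  rw [bivector, LinearMap.map_smul_of_tower, map_sum, hcons]
  simp only [pairing_wedge, pairing_opTheta, pairing_single, Finset.univ_unique,
    Finset.prod_singleton, totalDJ_zero, one_mul, dotProduct]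

theorem mapRange_prEv_bivector (V : Fin q → 𝒜 M r) (E : MatDiffOp M r) :
    Finsupp.mapRange.linearMap (prEv V).toLinearMap (bivector E) =
      bivector (MatDiffOp.derivAlong V E) := by
  rw [bivector_eq_mapDomain, bivector_eq_mapDomain, map_smul]
  simp only [map_sum, MatDiffOp.derivAlong_apply, Finsupp.mapRange.linearMap_apply]
  congr 1
  refine Finset.sum_congr rfl fun α _ => Finset.sum_congr rfl fun β _ => ?_
  rw [Finsupp.mapDomain_mapRange _ _ _ (map_zero _) (map_add _),
    Finsupp.mapDomain_mapRange _ _ _ (map_zero _) (map_add _)]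

end Prolong

/-! ### The Jacobi identity -/

section Jacobi

variable {I : Ideal (𝒜 M r)} {D E : MatDiffOp M r}

/-- The trilinear form `Q · E'[D P] R`, where `E'[V]` is the Fréchet derivative of `E` in the
direction `V`. -/
def frechetForm (D E : MatDiffOp M r) (P Q R : Fin q → 𝒜 M r) : 𝒜 M r :=
  Q ⬝ᵥ MatDiffOp.applyₗ (MatDiffOp.derivAlong (MatDiffOp.applyₗ D P) E) R

theorem pairing_prolong_bivector (D E : MatDiffOp M r) (P Q R : Fin q → 𝒜 M r) :
    MultiVec.pairing ![P, Q, R] (prolong D (bivector E)) =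
      (1 / 2 : ℝ) • frechetForm D E P Q R := by
  rw [Matrix.vecCons, MultiVec.pairing_prolong, mapRange_prEv_bivector, MultiVec.pairing_bivector,
    frechetForm]

theorem IsSkewAdjointMod.integral_frechetForm_swap (hI : IsJetIdeal I) (hE : IsSkewAdjointMod I E)
    (D : MatDiffOp M r) (P Q R : Fin q → 𝒜 M r) :
    integral I (frechetForm D E P Q R) = -integral I (frechetForm D E P R Q) :=
  hE.derivAlong hI _ Q R

/-- The cyclic sum of `∫ Q · E'[D P] R dx`, modulo the ideal `I`. -/
def jacobiForm (I : Ideal (𝒜 M r)) (D E : MatDiffOp M r) (P Q R : Fin q → 𝒜 M r) :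
    𝒜 M r ⧸ nullDensities I :=
  integral I (frechetForm D E P Q R) + integral I (frechetForm D E Q R P) +
    integral I (frechetForm D E R P Q)

theorem sum_sign_smul_comp {X V : Type*} [AddCommGroup V] (F : (Fin 3 → X) → V) (a b c : X) :
    ∑ σ : Equiv.Perm (Fin 3), (Equiv.Perm.sign σ : ℤ) • F (![a, b, c] ∘ σ) =
      F ![a, b, c] + F ![b, c, a] + F ![c, a, b] -
        F ![b, a, c] - F ![a, c, b] - F ![c, b, a] := by
  have huniv : (Finset.univ : Finset (Equiv.Perm (Fin 3))) = {1, finRotate 3, (finRotate 3)⁻¹,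
    Equiv.swap 0 1, Equiv.swap 1 2, Equiv.swap 0 2} := by decide
  have hterm (σ : Equiv.Perm (Fin 3)) (s : ℤˣ) (i j k : Fin 3)
      (hσ : Equiv.Perm.sign σ = s ∧ ⇑σ = ![i, j, k]) :
      (Equiv.Perm.sign σ : ℤ) • F (![a, b, c] ∘ σ) =
        (s : ℤ) • F ![![a, b, c] i, ![a, b, c] j, ![a, b, c] k] := by
    rw [hσ.1, hσ.2]
    exact congrArg _ (congrArg F (List.ofFn_injective rfl))
  rw [huniv]
  repeat rw [Finset.sum_insert (by decide)]
  rw [Finset.sum_singleton, hterm 1 1 0 1 2 (by decide), hterm (finRotate 3) 1 1 2 0 (by decide),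
    hterm (finRotate 3)⁻¹ 1 2 0 1 (by decide), hterm (Equiv.swap 0 1) (-1) 1 0 2 (by decide),
    hterm (Equiv.swap 1 2) (-1) 0 2 1 (by decide), hterm (Equiv.swap 0 2) (-1) 2 1 0 (by decide)]
  simp only [Units.val_one, Units.val_neg, Matrix.cons_val]
  module

theorem IsSkewAdjointMod.integral_pairing_alternation_prolong (hI : IsJetIdeal I)
    (hE : IsSkewAdjointMod I E) (D : MatDiffOp M r) (P Q R : Fin q → 𝒜 M r) :
    integral I (MultiVec.pairing ![P, Q, R] (MultiVec.alternation (prolong D (bivector E)))) =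
      jacobiForm I D E P Q R := by
  rw [MultiVec.pairing_alternation,
    sum_sign_smul_comp fun G => MultiVec.pairing G (prolong D (bivector E))]
  simp only [pairing_prolong_bivector, map_add, map_sub, map_smul,
    hE.integral_frechetForm_swap hI D Q P R, hE.integral_frechetForm_swap hI D P R Q,
    hE.integral_frechetForm_swap hI D R Q P, jacobiForm]
  module

/-- The outer bracket differentiates the inner one along the evolutionary vector field of `D δR`;
skew-adjointness then moves `D` off the differentiated factor `δL`. -/
theorem IsSkewAdjointMod.integral_bracket_bracket (hD : IsSkewAdjointMod I D) (P L R : 𝒜 M r) :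
    integral I (bracket D (bracket D P L) R) =
      integral I (frechetForm D D (euler R) (euler P) (euler L)) +
      integral I (MatDiffOp.applyₗ D (euler L) ⬝ᵥ
        (prEv (MatDiffOp.applyₗ D (euler R)) ∘ euler P)) -
      integral I (MatDiffOp.applyₗ D (euler P) ⬝ᵥ
        (prEv (MatDiffOp.applyₗ D (euler R)) ∘ euler L)) := by
  rw [bracket_eq_dotProduct D (bracket D P L), dotProduct_comm, integral_dotProduct_euler,
    bracket_eq_dotProduct, prEv_dotProduct_applyₗ, map_add, map_add, hD (euler P),
    dotProduct_comm (prEv _ ∘ euler P), dotProduct_comm (prEv _ ∘ euler L), frechetForm]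
  abel

theorem IsSkewAdjointMod.integral_jacobi (hI : IsJetIdeal I) (hD : IsSkewAdjointMod I D)
    (P L R : 𝒜 M r) :
    integral I (bracket D (bracket D P L) R + bracket D (bracket D L R) P +
      bracket D (bracket D R P) L) = jacobiForm I D D (euler P) (euler L) (euler R) := by
  rw [map_add, map_add, hD.integral_bracket_bracket, hD.integral_bracket_bracket,
    hD.integral_bracket_bracket,
    hI.integral_dotProduct_prEv_euler _ (MatDiffOp.applyₗ D (euler L)) P,
    hI.integral_dotProduct_prEv_euler _ (MatDiffOp.applyₗ D (euler R)) L,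
    hI.integral_dotProduct_prEv_euler _ (MatDiffOp.applyₗ D (euler P)) R,
    jacobiForm]
  abel

theorem IsSkewAdjointMod.isHamiltonianMod_iff (hI : IsJetIdeal I) (hD : IsSkewAdjointMod I D) :
    IsHamiltonianMod I D ↔
      ∀ P L R : 𝒜 M r, jacobiForm I D D (euler P) (euler L) (euler R) = 0 := by
  have hskew (P L : 𝒜 M r) : integral I (bracket D P L + bracket D L P) = 0 := by
    rw [map_add, bracket_eq_dotProduct, bracket_eq_dotProduct, hD, neg_add_cancel]
  simp only [IsHamiltonianMod, hskew, hD.integral_jacobi hI, implies_true, true_and]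

theorem jacobiForm_smul_add_smul (I : Ideal (𝒜 M r)) (D E : MatDiffOp M r) (a b : ℝ)
    (P Q R : Fin q → 𝒜 M r) :
    jacobiForm I (a • D + b • E) (a • D + b • E) P Q R =
      (a * a) • jacobiForm I D D P Q R +
        (a * b) • (jacobiForm I D E P Q R + jacobiForm I E D P Q R) +
        (b * b) • jacobiForm I E E P Q R := by
  simp only [jacobiForm, frechetForm, map_add, map_smul, LinearMap.add_apply,
    LinearMap.smul_apply, dotProduct_add, dotProduct_smul]
  module

theorem IsSkewAdjointMod.isNullMod_prolong_add_prolong_iff (hI : IsJetIdeal I)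
    (hD : IsSkewAdjointMod I D) (hE : IsSkewAdjointMod I E) :
    MultiVec.IsNullMod I (prolong D (bivector E) + prolong E (bivector D)) ↔
      ∀ P L R : 𝒜 M r, jacobiForm I D E (euler P) (euler L) (euler R) +
        jacobiForm I E D (euler P) (euler L) (euler R) = 0 := by
  have heuler (L : Fin 3 → 𝒜 M r) :
      (fun s => euler (L s)) = ![euler (L 0), euler (L 1), euler (L 2)] :=
    List.ofFn_injective rfl
  simp only [hI.isNullMod_iff_integral_pairing, heuler, map_add,
    hE.integral_pairing_alternation_prolong hI, hD.integral_pairing_alternation_prolong hI]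
  exact ⟨fun h P L R => h ![P, L, R], fun h L => h (L 0) (L 1) (L 2)⟩

end Jacobi

theorem IsHamiltonian.isSkewAdjoint {D : MatDiffOp M r} (hD : IsHamiltonian D) :
    IsSkewAdjoint D :=
  isSkewAdjoint_iff.2 ((isHamiltonian_iff.1 hD).isSkewAdjointMod isJetIdeal_bot)

theorem IsHamiltonian.isApproxHamiltonian {D : MatDiffOp M r} (hD : IsHamiltonian D) (N : ℕ) :
    IsApproxHamiltonian N D :=
  isApproxHamiltonian_iff.2 ((isHamiltonian_iff.1 hD).mono bot_le)

end ApproxHam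

end

theorem mainTheorem6_general {p q : ℕ} {M : ApproxHam.BaseDomain p q} {r : ℝ}
    {I : Ideal (ApproxHam.𝒜 M r)} (hI : ApproxHam.IsJetIdeal I) {D E : ApproxHam.MatDiffOp M r}
    (hD : ApproxHam.IsHamiltonianMod I D) (hE : ApproxHam.IsHamiltonianMod I E) :
    (∀ a b : ℝ, ApproxHam.IsHamiltonianMod I (a • D + b • E)) ↔
      ApproxHam.MultiVec.IsNullMod I
        (ApproxHam.prolong D (ApproxHam.bivector E) +
          ApproxHam.prolong E (ApproxHam.bivector D)) := by
  have hDskew := hD.isSkewAdjointMod hI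
  have hEskew := hE.isSkewAdjointMod hI
  have hDjac := (hDskew.isHamiltonianMod_iff hI).1 hD
  have hEjac := (hEskew.isHamiltonianMod_iff hI).1 hE
  have hlin (a b : ℝ) := (hDskew.smul_add_smul hEskew a b).isHamiltonianMod_iff hI
  simp only [ApproxHam.jacobiForm_smul_add_smul, hDjac, hEjac, smul_zero, zero_add,
    add_zero] at hlin
  rw [hDskew.isNullMod_prolong_add_prolong_iff hI hEskew]
  refine ⟨fun h P L R => ?_, fun h a b => (hlin a b).2 fun P L R => ?_⟩
  · simpa only [mul_one, one_smul] using (hlin 1 1).1 (h 1 1) P L R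
  · rw [h, smul_zero]

theorem ApproxHam.isApproxHamiltonianPair_iff {p q : ℕ} {M : ApproxHam.BaseDomain p q} {r : ℝ}
    {N : ℕ} {D E : ApproxHam.MatDiffOp M r} (hD : ApproxHam.IsSkewAdjoint D)
    (hE : ApproxHam.IsSkewAdjoint E) (hDN : ApproxHam.IsApproxHamiltonian N D)
    (hEN : ApproxHam.IsApproxHamiltonian N E) :
    ApproxHam.IsApproxHamiltonianPair N D E ↔ ApproxHam.MultiVec.IntegralSmall N
      (ApproxHam.prolong D (ApproxHam.bivector E) +
        ApproxHam.prolong E (ApproxHam.bivector D)) := by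
  rw [isApproxHamiltonian_iff] at hDN hEN
  simp only [IsApproxHamiltonianPair, hD, hE, true_and, isApproxHamiltonian_iff]
  exact mainTheorem6_general (isJetIdeal_smallIdeal N) hDN hEN

theorem mainTheorem6 {p q : ℕ} (M : ApproxHam.BaseDomain p q) (r : ℝ) (hr : 0 < r) (N : ℕ)
    (D E : ApproxHam.MatDiffOp M r) :
    (ApproxHam.IsHamiltonian D → ApproxHam.IsHamiltonian E →
      (ApproxHam.IsApproxHamiltonianPair N D E ↔
        ApproxHam.MultiVec.IntegralSmall N
          (ApproxHam.prolong D (ApproxHam.bivector E) +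
            ApproxHam.prolong E (ApproxHam.bivector D)))) ∧
    (ApproxHam.IsSkewAdjoint D → ApproxHam.IsSkewAdjoint E →
      ApproxHam.IsApproxHamiltonian N D → ApproxHam.IsApproxHamiltonian N E →
      (ApproxHam.IsApproxHamiltonianPair N D E ↔
        ApproxHam.MultiVec.IntegralSmall N
          (ApproxHam.prolong D (ApproxHam.bivector E) +
            ApproxHam.prolong E (ApproxHam.bivector D)))) :=
  ⟨fun hD hE => ApproxHam.isApproxHamiltonianPair_iff hD.isSkewAdjoint hE.isSkewAdjoint
    (hD.isApproxHamiltonian N) (hE.isApproxHamiltonian N), ApproxHam.isApproxHamiltonianPair_iff⟩
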